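/- Let $\lambda,\mu_1,\mu_2>0$, $\rho_i=\lambda/\mu_i$, and consider the two-node tandem Jackson network with Poisson arrivals of rate $\lambda$, exponential service rates $\mu_1,\mu_2$, and capacity $m\ge 1$ of the first queue (arrivals finding it full are rejected). View it as a quasi-birth-and-death process whose phase in $\{0,\dots,m\}$ is the length of the first queue and whose level is the length of the second queue. Its rate blocks are the $(m+1)\times(m+1)$ matrices $Q_0$ (level up: $Q_0(i,i-1)=\mu_1$ for $i\ge1$, other entries $0$), $Q_2=\mu_2 I$ (level down), and $Q_1$ (same level: $Q_1(i,i+1)=\lambda$, $Q_1(i,i)=-(\lambda 1_{i<m}+\mu_1 1_{i>0}+\mu_2)$, other entries $0$). Let $H_m$ be the limit, as $k\to\infty$, of the elementwise increasing sequence of matrices whose $(i,j)$ entry is the probability that the process, started at level $k$ in phase $i$, hits level $k+1$ before level $0$ and does so in phase $j$; equivalently, $H_m$ is the elementwise minimal nonnegative solution of $Q_0+Q_1H+Q_2H^2=0$. Let $R_m$ be the elementwise minimal nonnegative solution of $Q_0+RQ_1+R^2Q_2=0$. The maximal eigenvalue of a matrix is the real eigenvalue that is at least the modulus of every complex eigenvalue.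 For $z\in(0,1)$ define polynomials in $x$ by $P_0=1$, $\frac{\mu_1}{z}P_1(x;z)=x+\lambda+\mu_2(1-z)$, $\frac{\mu_1}{z}P_n(x;z)=(x+\lambda+\mu_1+\mu_2(1-z))P_{n-1}(x;z)-\lambda P_{n-2}(x;z)$ for $n\ge2$, and $\hat P_n(x;z)=P_n(x;z)-\frac{\lambda z}{\mu_1}P_{n-1}(x;z)$ for $n\ge1$. Let $\hat x_{n,n}(z)$ be the largest real zero of $\hat P_n(\cdot;z)$. **Theorem 8.1.** 1. Let $1\le m<\infty$ and suppose the network is stable, i.e. $\rho_2<\frac{1-\rho_1^{m+1}}{1-\rho_1^m}$ if $\rho_1\ne1$, and $\rho_2<1+\frac1m$ if $\rho_1=1$. Then there is a unique $\hat z_{m+1}\in(0,1)$ with $\hat x_{m+1,m+1}(\hat z_{m+1})=0$. The maximal eigenvalue $h_m$ of $H_m$ is $\hat z_{m+1}$, and this is also the maximal eigenvalue of $R_m$. 2. Suppose $\lambda<\min\{\mu_1,\mu_2\}$. Then the function $\tau(z)=-\lambda-\mu_1-\mu_2(1-z)+2\sqrt{\lambda\mu_1/z}$ has a unique zero $\eta$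 in $(0,1)$, and the sequence $h_1,h_2,\dots$ is strictly increasing, with limit $\eta$ if $\mu_1\le\mu_2$ and limit $\rho_2$ if $\mu_1>\mu_2$. -/

import Mathlib

open Filter Topology

namespace TandemQBD

section General

variable {n : ℕ}

/-- Probability that the embedded jump chain of a quasi-birth-and-death process with level-up,
within-level and level-down rate blocks `Q₀`, `Q₁`, `Q₂`, started at level `k` in phase `i`,
has hit level `0` or level `K` after at most `N` jumps and was in phase `j` at level `K` at that
first hitting time. Only starting levels `k ≤ K` matter. At a level strictly between `0` and `K`
the process leaves the state `(k, i)` at the total rate `-Q₁ i i`, so that each transition rate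
is divided by `-Q₁ i i` to give the jump probability. The process is stopped
on reaching level `0`, so that its transition rates there play no role. -/
noncomputable def exitWithin (Q₀ Q₁ Q₂ : Matrix (Fin n) (Fin n) ℝ) (K : ℕ) (j : Fin n) :
    ℕ → ℕ → Fin n → ℝ
  | 0, k, i => if k = K ∧ i = j then 1 else 0
  | N + 1, k, i =>
      if k = 0 ∨ k = K then (if k = K ∧ i = j then 1 else 0)
      else ∑ l, (Q₀ i l * exitWithin Q₀ Q₁ Q₂ K j N (k + 1) l
          + (if l = i then 0 else Q₁ i l) * exitWithin Q₀ Q₁ Q₂ K j N k l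
          + Q₂ i l * exitWithin Q₀ Q₁ Q₂ K j N (k - 1) l) / (-Q₁ i i)

/-- The matrix of first exit probabilities: `exitMatrix Q₀ Q₁ Q₂ k K i j` is the probability that
the process started at level `k` in phase `i` hits level `K` before level `0`, and does so in
phase `j`. The probabilities of doing so within `N` jumps increase to it. -/
noncomputable def exitMatrix (Q₀ Q₁ Q₂ : Matrix (Fin n) (Fin n) ℝ) (k K : ℕ) :
    Matrix (Fin n) (Fin n) ℝ :=
  Matrix.of fun i j => ⨆ N : ℕ, exitWithin Q₀ Q₁ Q₂ K j N k i

/-- The matrix `H`: the elementwise limit of the increasing sequence (in `k`) of the matrices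
`H_k` of the probabilities of hitting level `k + 1` before level `0` from level `k`. -/
noncomputable def hitMatrix (Q₀ Q₁ Q₂ : Matrix (Fin n) (Fin n) ℝ) :
    Matrix (Fin n) (Fin n) ℝ :=
  Matrix.of fun i j => ⨆ k : ℕ, exitMatrix Q₀ Q₁ Q₂ k (k + 1) i j

/-- `H` is the (elementwise) minimal nonnegative solution of `Q₀ + Q₁ H + Q₂ H² = 0`. -/
def IsMinimalH (Q₀ Q₁ Q₂ H : Matrix (Fin n) (Fin n) ℝ) : Prop :=
  ((∀ i j, 0 ≤ H i j) ∧ Q₀ + Q₁ * H + Q₂ * (H * H) = 0) ∧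
    ∀ X : Matrix (Fin n) (Fin n) ℝ, (∀ i j, 0 ≤ X i j) →
      Q₀ + Q₁ * X + Q₂ * (X * X) = 0 → ∀ i j, H i j ≤ X i j

/-- `R` is the (elementwise) minimal nonnegative solution of `Q₀ + R Q₁ + R² Q₂ = 0`. -/
def IsMinimalR (Q₀ Q₁ Q₂ R : Matrix (Fin n) (Fin n) ℝ) : Prop :=
  ((∀ i j, 0 ≤ R i j) ∧ Q₀ + R * Q₁ + R * R * Q₂ = 0) ∧
    ∀ X : Matrix (Fin n) (Fin n) ℝ, (∀ i j, 0 ≤ X i j) →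
      Q₀ + X * Q₁ + X * X * Q₂ = 0 → ∀ i j, R i j ≤ X i j

/-- `h` is the maximal eigenvalue of the real matrix `A`: it is an eigenvalue, and it is at least
the modulus of every complex eigenvalue. At most one `h` has this property. -/
def IsMaximalEigenvalue (A : Matrix (Fin n) (Fin n) ℝ) (h : ℝ) : Prop :=
  Module.End.HasEigenvalue (Matrix.toLin' A) h ∧
    ∀ w : ℂ, Module.End.HasEigenvalue (Matrix.toLin' (A.map (algebraMap ℝ ℂ))) w → ‖w‖ ≤ h

end General

/-! The tandem network: arrival rate `lam`, service rates `μ₁`, `μ₂`, capacity `m` of the first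
queue. The phase in `{0, …, m}` is the number of customers in the first queue, the level the
number of customers in the second queue. -/

/-- Level-up block: a service completion in the first queue. -/
def Q0 (μ₁ : ℝ) (m : ℕ) : Matrix (Fin (m + 1)) (Fin (m + 1)) ℝ :=
  Matrix.of fun i j => if (i : ℕ) = j + 1 then μ₁ else 0

/-- Within-level block: arrivals to the first queue (rejected in phase `m`) and the diagonal. -/
def Q1 (lam μ₁ μ₂ : ℝ) (m : ℕ) : Matrix (Fin (m + 1)) (Fin (m + 1)) ℝ :=
  Matrix.of fun i j =>
    if (j : ℕ) = i + 1 then lam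
    else if i = j then
      -((if (i : ℕ) < m then lam else 0) + (if 0 < (i : ℕ) then μ₁ else 0) + μ₂)
    else 0

/-- Level-down block: a service completion in the second queue. -/
def Q2 (μ₂ : ℝ) (m : ℕ) : Matrix (Fin (m + 1)) (Fin (m + 1)) ℝ :=
  Matrix.of fun i j => if i = j then μ₂ else 0

/-- The matrix `H_m` of the tandem network with capacity `m` of the first queue. -/
noncomputable def tandemH (lam μ₁ μ₂ : ℝ) (m : ℕ) : Matrix (Fin (m + 1)) (Fin (m + 1)) ℝ :=
  hitMatrix (Q0 μ₁ m) (Q1 lam μ₁ μ₂ m) (Q2 μ₂ m)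

/-- Stability condition for finite capacity `m ≥ 1`, where `ρᵢ = lam / μᵢ`. -/
def Stable (lam μ₁ μ₂ : ℝ) (m : ℕ) : Prop :=
  (lam / μ₁ ≠ 1 → lam / μ₂ < (1 - (lam / μ₁) ^ (m + 1)) / (1 - (lam / μ₁) ^ m)) ∧
    (lam / μ₁ = 1 → lam / μ₂ < 1 + 1 / (m : ℝ))

/-- The polynomials `P_n(x; z)` in `x`. -/
noncomputable def P (lam μ₁ μ₂ z : ℝ) : ℕ → ℝ → ℝ
  | 0, _ => 1
  | 1, x => z / μ₁ * (x + lam + μ₂ * (1 - z))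
  | n + 2, x => z / μ₁ * ((x + lam + μ₁ + μ₂ * (1 - z)) * P lam μ₁ μ₂ z (n + 1) x
      - lam * P lam μ₁ μ₂ z n x)

/-- The polynomials `P̂_n(x; z)` in `x`. -/
noncomputable def Phat (lam μ₁ μ₂ z : ℝ) : ℕ → ℝ → ℝ
  | 0, _ => 1
  | n + 1, x => P lam μ₁ μ₂ z (n + 1) x - lam * z / μ₁ * P lam μ₁ μ₂ z n x

/-- `x` is `x̂_{n,n}(z)`, the largest zero of `P̂_n(·; z)`. -/
def IsLargestZero (lam μ₁ μ₂ z : ℝ) (n : ℕ) (x : ℝ) : Prop :=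
  IsGreatest {y : ℝ | Phat lam μ₁ μ₂ z n y = 0} x

/-- The function `τ(z)`. -/
noncomputable def tau (lam μ₁ μ₂ z : ℝ) : ℝ :=
  -lam - μ₁ - μ₂ * (1 - z) + 2 * √(lam * μ₁ / z)

end TandemQBD

/-! Look for functions of the form `z ^ (K - k) • w` that are harmonic for the process at interior
levels: this needs `Q₀ w + z Q₁ w + z² Q₂ w = 0`, that is, `w` in the kernel of `z⁻¹ Q₀ + Q₁ + z
Q₂`. If `0 < z < 1` and `w > 0`, comparison with such a function from above and a maximum principle
from below give `H w = z w` (`hitMatrix_mulVec`), and a positive eigenvector of a nonnegative matrix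
belongs to the maximal eigenvalue. The same argument for the transposed blocks gives `R`, because
transposition exchanges the two quadratic equations.

For the tandem network the matrix is tridiagonal in the phase. Up to scaling, an eigenvector for the
eigenvalue `x` has entries `P n`, and the condition at the last phase is `Phat (m + 1) = 0`. Its
largest eigenvalue is at most `x` as soon as there is a positive supersolution, which `IsSuper`
expresses. So the task is to find `z` with `IsSuper (z, 0)` and `Phat = 0`. The least `z` with
`IsSuper (z, 0)` is such a point, because `IsSuper` is closed, and open where `Phat > 0`. Stability
makes `Phat` decrease through `0` at `z = 1`, so that some `z < 1` qualifies. The root is unique by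
log-convexity: a power of a positive kernel vector at `y` is a strict supersolution at a larger `z <
1`, which excludes a second root.

For the second part, `ρ₂` is a strict supersolution point for every `m`, and `IsSuper` at `m + 1`
implies strict `IsSuper` at `m` below `μ₁ / μ₂`. Hence the roots increase strictly to some `L ≤ ρ₂`,
and all `P n` are positive at `L`. The ratios `P (n + 1) / P n` follow a Möbius recursion whose
fixed points are real iff `τ ≤ 0`, so positivity forces `τ(L) ≤ 0`, i.e. `η ≤ L`. If `μ₁ ≤ μ₂`, the
ratios at `η` start above the double fixed point and never fall below it, so `L ≤ η`. If `μ₂ < μ₁`,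
then for `z < ρ₂` they start below the lower fixed point even when the fixed points are real, and
become negative, so `L = ρ₂`. -/

namespace TandemQBD

/-! ### Exit probabilities and the matrix `H` for general quasi-birth-and-death blocks -/

section GeneralQBD

variable {n : ℕ}

/-- The generator of a quasi-birth-and-death process applied to a function of level and phase. -/
def generator (Q₀ Q₁ Q₂ : Matrix (Fin n) (Fin n) ℝ) (f : ℕ → Fin n → ℝ) (k : ℕ) (i : Fin n) : ℝ :=
  ∑ l, (Q₀ i l * f (k + 1) l + Q₁ i l * f k l + Q₂ i l * f (k - 1) l)

/-- The transition operator of the embedded jump chain at an interior level. -/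
noncomputable def firstStep (Q₀ Q₁ Q₂ : Matrix (Fin n) (Fin n) ℝ) (f : ℕ → Fin n → ℝ)
    (k : ℕ) (i : Fin n) : ℝ :=
  ∑ l, (Q₀ i l * f (k + 1) l + (if l = i then 0 else Q₁ i l) * f k l
    + Q₂ i l * f (k - 1) l) / (-Q₁ i i)

/-- Sign conditions on the rate blocks, together with a positive harmonic vector that does not
depend on the level. -/
structure IsRateBlocks (Q₀ Q₁ Q₂ : Matrix (Fin n) (Fin n) ℝ) (e : Fin n → ℝ) : Prop where
  up_nonneg : ∀ i j, 0 ≤ Q₀ i j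
  within_nonneg : ∀ i j, j ≠ i → 0 ≤ Q₁ i j
  down_nonneg : ∀ i j, 0 ≤ Q₂ i j
  diag_neg : ∀ i, Q₁ i i < 0
  down_diag_pos : ∀ i, 0 < Q₂ i i
  pos : ∀ i, 0 < e i
  harmonic : ∀ i, ∑ l, (Q₀ i l * e l + Q₁ i l * e l + Q₂ i l * e l) = 0

variable {Q₀ Q₁ Q₂ : Matrix (Fin n) (Fin n) ℝ} {e : Fin n → ℝ}

theorem firstStep_eq (h : ∀ i, Q₁ i i < 0) (f : ℕ → Fin n → ℝ) (k : ℕ) (i : Fin n) :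
    firstStep Q₀ Q₁ Q₂ f k i = f k i + generator Q₀ Q₁ Q₂ f k i / (-Q₁ i i) := by
  have hi := h i
  have h1 : ∑ l, (Q₀ i l * f (k + 1) l + (if l = i then 0 else Q₁ i l) * f k l
      + Q₂ i l * f (k - 1) l) = generator Q₀ Q₁ Q₂ f k i - Q₁ i i * f k i := by
    have h2 : ∑ l, (if l = i then Q₁ i l * f k l else 0) = Q₁ i i * f k i := by simp
    rw [generator, ← h2, ← Finset.sum_sub_distrib]
    refine Finset.sum_congr rfl fun l _ => ?_
    split_ifs <;> ring
  rw [firstStep, ← Finset.sum_div, h1]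
  have : Q₁ i i ≠ 0 := hi.ne
  field_simp
  ring

theorem generator_sub (f g : ℕ → Fin n → ℝ) (k : ℕ) (i : Fin n) :
    generator Q₀ Q₁ Q₂ (fun k i => f k i - g k i) k i
      = generator Q₀ Q₁ Q₂ f k i - generator Q₀ Q₁ Q₂ g k i := by
  simp only [generator, ← Finset.sum_sub_distrib]
  exact Finset.sum_congr rfl fun l _ => by ring

theorem generator_eq_mulVec (f : ℕ → Fin n → ℝ) (k : ℕ) :
    generator Q₀ Q₁ Q₂ f k
      = Q₀.mulVec (f (k + 1)) + Q₁.mulVec (f k) + Q₂.mulVec (f (k - 1)) := by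
  ext i
  simp only [generator, Finset.sum_add_distrib, Pi.add_apply, Matrix.mulVec, dotProduct]

namespace IsRateBlocks

theorem firstStep_mono (h : IsRateBlocks Q₀ Q₁ Q₂ e) {f g : ℕ → Fin n → ℝ} {k : ℕ}
    (h1 : ∀ l, f (k + 1) l ≤ g (k + 1) l) (h2 : ∀ l, f k l ≤ g k l)
    (h3 : ∀ l, f (k - 1) l ≤ g (k - 1) l) (i : Fin n) :
    firstStep Q₀ Q₁ Q₂ f k i ≤ firstStep Q₀ Q₁ Q₂ g k i := by
  refine Finset.sum_le_sum fun l _ => ?_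
  have hd : 0 < -Q₁ i i := neg_pos.2 (h.diag_neg i)
  have hq : 0 ≤ (if l = i then 0 else Q₁ i l) := by
    split_ifs with hl
    · exact le_rfl
    · exact h.within_nonneg i l hl
  gcongr
  · exact h.up_nonneg i l
  · exact h1 l
  · exact h2 l
  · exact h.down_nonneg i l
  · exact h3 l

theorem exitWithin_le_succ (h : IsRateBlocks Q₀ Q₁ Q₂ e) (K : ℕ) (j : Fin n) (N : ℕ) :
    ∀ k i, exitWithin Q₀ Q₁ Q₂ K j N k i ≤ exitWithin Q₀ Q₁ Q₂ K j (N + 1) k i := by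
  have hnn : ∀ k i, 0 ≤ exitWithin Q₀ Q₁ Q₂ K j 0 k i := fun k i => by
    simp only [exitWithin]; split_ifs <;> norm_num
  induction N with
  | zero =>
    intro k i
    rw [exitWithin]
    by_cases hk : k = 0 ∨ k = K
    · rw [exitWithin, if_pos hk]
    · rw [exitWithin, if_neg hk, if_neg (fun hh => hk (Or.inr hh.1))]
      have := h.firstStep_mono (f := fun _ _ => 0) (g := exitWithin Q₀ Q₁ Q₂ K j 0) (k := k)
        (hnn _) (hnn _) (hnn _) i
      simpa [firstStep] using this
  | succ N ih =>
    intro k i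
    rw [exitWithin, exitWithin]
    by_cases hk : k = 0 ∨ k = K
    · rw [if_pos hk, if_pos hk]
    · rw [if_neg hk, if_neg hk]
      exact h.firstStep_mono (ih _) (ih _) (ih _) i

theorem exitWithin_mono (h : IsRateBlocks Q₀ Q₁ Q₂ e) (K : ℕ) (j : Fin n) (k : ℕ) (i : Fin n) :
    Monotone fun N => exitWithin Q₀ Q₁ Q₂ K j N k i :=
  monotone_nat_of_le_succ fun N => h.exitWithin_le_succ K j N k i

theorem exitWithin_nonneg (h : IsRateBlocks Q₀ Q₁ Q₂ e) (K : ℕ) (j : Fin n) (N k : ℕ) (i : Fin n) :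
    0 ≤ exitWithin Q₀ Q₁ Q₂ K j N k i := by
  refine le_trans ?_ (h.exitWithin_mono K j k i (Nat.zero_le N))
  simp only [exitWithin]; split_ifs <;> norm_num

/-- Exit distributions are dominated by every nonnegative superharmonic function. -/
theorem sum_exitWithin_mul_le (h : IsRateBlocks Q₀ Q₁ Q₂ e) {K : ℕ} {c : Fin n → ℝ}
    {f : ℕ → Fin n → ℝ} (hf : ∀ k ≤ K, ∀ i, 0 ≤ f k i) (hK : ∀ i, c i ≤ f K i)
    (hs : ∀ k, 0 < k → k < K → ∀ i, generator Q₀ Q₁ Q₂ f k i ≤ 0) (N : ℕ) :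
    ∀ k ≤ K, ∀ i, ∑ j, exitWithin Q₀ Q₁ Q₂ K j N k i * c j ≤ f k i := by
  have hbdry : ∀ k ≤ K, ∀ i, ∑ j, (if k = K ∧ i = j then (1 : ℝ) else 0) * c j ≤ f k i := by
    intro k hk i
    by_cases hkK : k = K
    · subst hkK
      simpa using hK i
    · simpa [hkK] using hf k hk i
  induction N with
  | zero => intro k hk i; simpa only [exitWithin] using hbdry k hk i
  | succ N ih =>
    intro k hk i
    by_cases hkb : k = 0 ∨ k = K
    · simp only [exitWithin, if_pos hkb]
      exact hbdry k hk i
    · simp only [exitWithin, if_neg hkb]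
      push Not at hkb
      have hk0 : 0 < k := Nat.pos_of_ne_zero hkb.1
      have hkK : k < K := lt_of_le_of_ne hk hkb.2
      have hd : 0 < -Q₁ i i := neg_pos.2 (h.diag_neg i)
      calc _ = firstStep Q₀ Q₁ Q₂
            (fun k i => ∑ j, exitWithin Q₀ Q₁ Q₂ K j N k i * c j) k i := by
            simp only [firstStep, Finset.sum_mul, Finset.mul_sum, Finset.sum_div,
              ← Finset.sum_add_distrib]
            rw [Finset.sum_comm]
            refine Finset.sum_congr rfl fun l _ => Finset.sum_congr rfl fun j _ => ?_
            ring
        _ ≤ firstStep Q₀ Q₁ Q₂ f k i :=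
            h.firstStep_mono (ih _ (by omega)) (ih _ hk) (ih _ (by omega)) i
        _ ≤ f k i := by
            rw [firstStep_eq h.diag_neg]
            have := div_nonpos_of_nonpos_of_nonneg (hs k hk0 hkK i) hd.le
            linarith

/-- The level-independent harmonic function `e i / e j` dominates. This bound makes the suprema in
`exitMatrix` and `hitMatrix` genuine limits; `e` replaces the constant `1` because transposed blocks
need not have zero row sums. -/
theorem exitWithin_le (h : IsRateBlocks Q₀ Q₁ Q₂ e) {K k : ℕ} (hk : k ≤ K) (j : Fin n) (N : ℕ)
    (i : Fin n) : exitWithin Q₀ Q₁ Q₂ K j N k i ≤ e i / e j := by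
  have := h.sum_exitWithin_mul_le (K := K) (c := Pi.single j 1) (f := fun _ i => e i / e j)
    (fun _ _ i => (div_pos (h.pos i) (h.pos j)).le) (fun i => by
      by_cases hij : i = j
      · subst hij; simp [(h.pos i).ne']
      · simpa [hij] using (div_pos (h.pos i) (h.pos j)).le)
    (fun k _ _ i => by
      have h1 := h.harmonic i
      have : generator Q₀ Q₁ Q₂ (fun _ i => e i / e j) k i
          = (∑ l, (Q₀ i l * e l + Q₁ i l * e l + Q₂ i l * e l)) / e j := by
        rw [generator, Finset.sum_div]
        exact Finset.sum_congr rfl fun l _ => by ring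
      rw [this, h1, zero_div]) N k hk i
  simpa [Pi.single_apply] using this

theorem tendsto_exitWithin (h : IsRateBlocks Q₀ Q₁ Q₂ e) {K k : ℕ} (hk : k ≤ K) (i j : Fin n) :
    Tendsto (fun N => exitWithin Q₀ Q₁ Q₂ K j N k i) atTop (𝓝 (exitMatrix Q₀ Q₁ Q₂ k K i j)) :=
  tendsto_atTop_ciSup (h.exitWithin_mono K j k i)
    ⟨e i / e j, by rintro _ ⟨N, rfl⟩; exact h.exitWithin_le hk j N i⟩

theorem exitMatrix_nonneg (h : IsRateBlocks Q₀ Q₁ Q₂ e) {K k : ℕ} (hk : k ≤ K) (i j : Fin n) :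
    0 ≤ exitMatrix Q₀ Q₁ Q₂ k K i j :=
  ge_of_tendsto' (h.tendsto_exitWithin hk i j) fun N => h.exitWithin_nonneg K j N k i

theorem exitMatrix_le (h : IsRateBlocks Q₀ Q₁ Q₂ e) {K k : ℕ} (hk : k ≤ K) (i j : Fin n) :
    exitMatrix Q₀ Q₁ Q₂ k K i j ≤ e i / e j :=
  le_of_tendsto' (h.tendsto_exitWithin hk i j) fun N => h.exitWithin_le hk j N i

theorem exitMatrix_self (Q₀ Q₁ Q₂ : Matrix (Fin n) (Fin n) ℝ) (K : ℕ) :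
    exitMatrix Q₀ Q₁ Q₂ K K = 1 := by
  ext i j
  have : ∀ N, exitWithin Q₀ Q₁ Q₂ K j N K i = if i = j then 1 else 0 := by
    intro N; cases N <;> simp [exitWithin]
  simp [exitMatrix, this, Matrix.one_apply]

theorem exitMatrix_zero (Q₀ Q₁ Q₂ : Matrix (Fin n) (Fin n) ℝ) {K : ℕ} (hK : 0 < K) :
    exitMatrix Q₀ Q₁ Q₂ 0 K = 0 := by
  ext i j
  have : ∀ N, exitWithin Q₀ Q₁ Q₂ K j N 0 i = 0 := by
    intro N; cases N <;> simp [exitWithin, hK.ne]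
  simp [exitMatrix, this]

/-- `exitMatrix` is dominated by every nonnegative superharmonic function. -/
theorem exitMatrix_mulVec_le (h : IsRateBlocks Q₀ Q₁ Q₂ e) {K : ℕ} {c : Fin n → ℝ}
    {f : ℕ → Fin n → ℝ} (hf : ∀ k ≤ K, ∀ i, 0 ≤ f k i) (hK : ∀ i, c i ≤ f K i)
    (hs : ∀ k, 0 < k → k < K → ∀ i, generator Q₀ Q₁ Q₂ f k i ≤ 0) {k : ℕ} (hk : k ≤ K)
    (i : Fin n) : (exitMatrix Q₀ Q₁ Q₂ k K).mulVec c i ≤ f k i := by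
  refine le_of_tendsto' (x := atTop)
    (f := fun N => ∑ j, exitWithin Q₀ Q₁ Q₂ K j N k i * c j) ?_
    fun N => h.sum_exitWithin_mul_le hf hK hs N k hk i
  exact tendsto_finsetSum _ fun j _ => (h.tendsto_exitWithin hk i j).mul_const _

theorem generator_exitMatrix_apply (h : IsRateBlocks Q₀ Q₁ Q₂ e) {K k : ℕ} (hk : 0 < k)
    (hkK : k < K) (i j : Fin n) :
    generator Q₀ Q₁ Q₂ (fun k i => exitMatrix Q₀ Q₁ Q₂ k K i j) k i = 0 := by
  have h1 : Tendsto (fun N => exitWithin Q₀ Q₁ Q₂ K j (N + 1) k i) atTop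
      (𝓝 (exitMatrix Q₀ Q₁ Q₂ k K i j)) :=
    (tendsto_add_atTop_iff_nat 1).2 (h.tendsto_exitWithin hkK.le i j)
  have h2 : Tendsto (fun N => exitWithin Q₀ Q₁ Q₂ K j (N + 1) k i) atTop
      (𝓝 (firstStep Q₀ Q₁ Q₂ (fun k i => exitMatrix Q₀ Q₁ Q₂ k K i j) k i)) := by
    have hkb : ¬ (k = 0 ∨ k = K) := by omega
    simp only [exitWithin, if_neg hkb]
    refine tendsto_finsetSum _ fun l _ => Tendsto.div_const ?_ _
    exact (((h.tendsto_exitWithin (by omega) l j).const_mul _).add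
      ((h.tendsto_exitWithin (by omega) l j).const_mul _)).add
      ((h.tendsto_exitWithin (by omega) l j).const_mul _)
  have h3 := tendsto_nhds_unique h1 h2
  rw [firstStep_eq h.diag_neg] at h3
  have h4 : generator Q₀ Q₁ Q₂ (fun k i => exitMatrix Q₀ Q₁ Q₂ k K i j) k i / (-Q₁ i i) = 0 := by
    linarith
  rcases div_eq_zero_iff.1 h4 with h5 | h5
  · exact h5
  · exact absurd (neg_eq_zero.1 h5) (h.diag_neg i).ne

theorem exitMatrix_firstStep (h : IsRateBlocks Q₀ Q₁ Q₂ e) {K k : ℕ} (hk : 0 < k) (hkK : k < K) :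
    Q₀ * exitMatrix Q₀ Q₁ Q₂ (k + 1) K + Q₁ * exitMatrix Q₀ Q₁ Q₂ k K
      + Q₂ * exitMatrix Q₀ Q₁ Q₂ (k - 1) K = 0 := by
  ext i j
  have := h.generator_exitMatrix_apply hk hkK i j
  simpa [generator, Finset.sum_add_distrib, Matrix.mul_apply] using this

theorem generator_exitMatrix (h : IsRateBlocks Q₀ Q₁ Q₂ e) {K k : ℕ} (hk : 0 < k) (hkK : k < K)
    (c : Fin n → ℝ) (i : Fin n) :
    generator Q₀ Q₁ Q₂ (fun k => (exitMatrix Q₀ Q₁ Q₂ k K).mulVec c) k i = 0 := by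
  rw [generator_eq_mulVec]
  simp only [Matrix.mulVec_mulVec, ← Matrix.add_mulVec]
  rw [h.exitMatrix_firstStep hk hkK]
  simp

/-- Minimality of exit probabilities, column by column; most comparisons below consist in supplying
a suitable `f`. -/
theorem col_exitMatrix_le (h : IsRateBlocks Q₀ Q₁ Q₂ e) {K : ℕ} {j : Fin n}
    {f : ℕ → Fin n → ℝ} (hf : ∀ k ≤ K, ∀ i, 0 ≤ f k i) (hK : 1 ≤ f K j)
    (hs : ∀ k, 0 < k → k < K → ∀ i, generator Q₀ Q₁ Q₂ f k i ≤ 0) {k : ℕ} (hk : k ≤ K)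
    (i : Fin n) : exitMatrix Q₀ Q₁ Q₂ k K i j ≤ f k i := by
  have := h.exitMatrix_mulVec_le (c := Pi.single j 1) hf (fun l => by
    by_cases hl : l = j
    · subst hl; simpa using hK
    · simpa [hl] using hf K le_rfl l) hs hk i
  simpa using this

/-- Shifting all levels up by one moves the absorbing level `0` further away, so the shifted exit
probabilities serve as a dominating harmonic function. -/
theorem exitMatrix_succ_mono (h : IsRateBlocks Q₀ Q₁ Q₂ e) (i j : Fin n) :
    Monotone fun k => exitMatrix Q₀ Q₁ Q₂ k (k + 1) i j := by
  refine monotone_nat_of_le_succ fun K => ?_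
  refine h.col_exitMatrix_le (f := fun k i => exitMatrix Q₀ Q₁ Q₂ (k + 1) (K + 1 + 1) i j)
    (fun k hk i => h.exitMatrix_nonneg (by omega) i j) ?_ (fun k hk hkK i => ?_) (Nat.le_succ K) i
  · rw [exitMatrix_self]; simp
  · have := h.generator_exitMatrix_apply (K := K + 1 + 1) (k := k + 1) (by omega) (by omega) i j
    obtain ⟨k, rfl⟩ : ∃ k', k = k' + 1 := ⟨k - 1, by omega⟩
    simpa [generator] using this.le

theorem tendsto_exitMatrix (h : IsRateBlocks Q₀ Q₁ Q₂ e) (i j : Fin n) :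
    Tendsto (fun k => exitMatrix Q₀ Q₁ Q₂ k (k + 1) i j) atTop (𝓝 (hitMatrix Q₀ Q₁ Q₂ i j)) :=
  tendsto_atTop_ciSup (h.exitMatrix_succ_mono i j)
    ⟨e i / e j, by rintro _ ⟨N, rfl⟩; exact h.exitMatrix_le (Nat.le_succ _) i j⟩

/-- Strong Markov property: to climb two levels the process has to climb one level twice. -/
theorem exitMatrix_mul (h : IsRateBlocks Q₀ Q₁ Q₂ e) {K : ℕ} (hK : 0 < K) :
    exitMatrix Q₀ Q₁ Q₂ (K - 1) (K + 1)
      = exitMatrix Q₀ Q₁ Q₂ (K - 1) K * exitMatrix Q₀ Q₁ Q₂ K (K + 1) := by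
  have hge : ∀ k ≤ K, ∀ i j, (exitMatrix Q₀ Q₁ Q₂ k K).mulVec
      (fun l => exitMatrix Q₀ Q₁ Q₂ K (K + 1) l j) i ≤ exitMatrix Q₀ Q₁ Q₂ k (K + 1) i j := by
    intro k hk i j
    exact h.exitMatrix_mulVec_le (f := fun k i => exitMatrix Q₀ Q₁ Q₂ k (K + 1) i j)
      (fun k hk i => h.exitMatrix_nonneg (by omega) i j) (fun i => le_rfl)
      (fun k hk hkK i => (h.generator_exitMatrix_apply hk (by omega) i j).le) hk i
  ext i j
  refine le_antisymm ?_ (hge (K - 1) (by omega) i j)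
  set c : Fin n → ℝ := fun l => exitMatrix Q₀ Q₁ Q₂ K (K + 1) l j with hc
  -- Glue the product below and at level `K` to the boundary value at `K + 1`. The result is
  -- harmonic below `K` and, by `hge`, superharmonic at `K`, so it dominates the exit probabilities
  -- to `K + 1`.
  set f : ℕ → Fin n → ℝ := fun k =>
    if k ≤ K then (exitMatrix Q₀ Q₁ Q₂ k K).mulVec c else Pi.single j 1 with hf
  have hfK : f K = c := by simp [hf, exitMatrix_self]
  have hfle : ∀ k ≤ K, f k = (exitMatrix Q₀ Q₁ Q₂ k K).mulVec c := fun k hk => by simp [hf, hk]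
  have hfsucc : f (K + 1) = Pi.single j 1 := by simp [hf]
  have hcnn : ∀ l, 0 ≤ c l := fun l => h.exitMatrix_nonneg (Nat.le_succ K) l j
  have := h.col_exitMatrix_le (K := K + 1) (j := j) (f := f) ?_ (by simp [hfsucc]) ?_
    (k := K - 1) (by omega) i
  · rw [hfle _ (by omega)] at this
    exact this
  · intro k hk i
    by_cases hkK : k ≤ K
    · rw [hfle k hkK, Matrix.mulVec, dotProduct]
      exact Finset.sum_nonneg fun l _ => mul_nonneg (h.exitMatrix_nonneg hkK i l) (hcnn l)
    · obtain rfl : k = K + 1 := by omega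
      rw [hfsucc, Pi.single_apply]
      split_ifs <;> norm_num
  · intro k hk hkK i
    rcases Nat.lt_or_ge k K with hlt | hge'
    · have h1 := h.generator_exitMatrix hk hlt c i
      rw [generator] at h1 ⊢
      rw [hfle _ hlt, hfle _ hlt.le, hfle (k - 1) (by omega)]
      exact h1.le
    · obtain rfl : k = K := by omega
      have h1 := h.generator_exitMatrix_apply hk (Nat.lt_succ_self k) i j
      rw [← h1, generator, generator, hfsucc, hfK]
      refine Finset.sum_le_sum fun l _ => ?_
      have h2 : f (k - 1) l ≤ exitMatrix Q₀ Q₁ Q₂ (k - 1) (k + 1) l j := by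
        rw [hfle _ (by omega)]
        exact hge (k - 1) (by omega) l j
      have h3 : exitMatrix Q₀ Q₁ Q₂ (k + 1) (k + 1) l j = (Pi.single j 1 : Fin n → ℝ) l := by
        rw [exitMatrix_self, Matrix.one_apply, Pi.single_apply]
      rw [h3]
      have := mul_le_mul_of_nonneg_left h2 (h.down_nonneg i l)
      simp only [hc]
      linarith

theorem hitMatrix_nonneg (h : IsRateBlocks Q₀ Q₁ Q₂ e) (i j : Fin n) :
    0 ≤ hitMatrix Q₀ Q₁ Q₂ i j :=
  ge_of_tendsto' (h.tendsto_exitMatrix i j) fun k => h.exitMatrix_nonneg (Nat.le_succ k) i j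

theorem tendsto_exitMatrix_matrix (h : IsRateBlocks Q₀ Q₁ Q₂ e) :
    Tendsto (fun k => exitMatrix Q₀ Q₁ Q₂ k (k + 1)) atTop (𝓝 (hitMatrix Q₀ Q₁ Q₂)) :=
  tendsto_pi_nhds.2 fun i => tendsto_pi_nhds.2 fun j => h.tendsto_exitMatrix i j

/-- Limit of the first-step equation one level below the target, where the strong Markov property
turns the down term into a product of two consecutive exit matrices. -/
theorem hitMatrix_equation (h : IsRateBlocks Q₀ Q₁ Q₂ e) :
    Q₀ + Q₁ * hitMatrix Q₀ Q₁ Q₂ + Q₂ * (hitMatrix Q₀ Q₁ Q₂ * hitMatrix Q₀ Q₁ Q₂) = 0 := by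
  have hlim := h.tendsto_exitMatrix_matrix
  have hlim1 := (tendsto_add_atTop_iff_nat 1).2 hlim
  have key : ∀ k, Q₀ + Q₁ * exitMatrix Q₀ Q₁ Q₂ (k + 1) (k + 1 + 1)
      + Q₂ * (exitMatrix Q₀ Q₁ Q₂ k (k + 1) * exitMatrix Q₀ Q₁ Q₂ (k + 1) (k + 1 + 1)) = 0 := by
    intro k
    have h1 := h.exitMatrix_firstStep (Nat.succ_pos k) (Nat.lt_succ_self (k + 1))
    have h2 := h.exitMatrix_mul (Nat.succ_pos k)
    simp only [Nat.succ_eq_add_one, Nat.add_sub_cancel] at h1 h2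
    rwa [exitMatrix_self, mul_one, h2] at h1
  have h3 : Tendsto (fun k => Q₀ + Q₁ * exitMatrix Q₀ Q₁ Q₂ (k + 1) (k + 1 + 1)
      + Q₂ * (exitMatrix Q₀ Q₁ Q₂ k (k + 1) * exitMatrix Q₀ Q₁ Q₂ (k + 1) (k + 1 + 1))) atTop
      (𝓝 (Q₀ + Q₁ * hitMatrix Q₀ Q₁ Q₂ + Q₂ * (hitMatrix Q₀ Q₁ Q₂ * hitMatrix Q₀ Q₁ Q₂))) :=
    (tendsto_const_nhds.add (tendsto_const_nhds.mul hlim1)).add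
      (tendsto_const_nhds.mul (hlim.mul hlim1))
  simp only [key] at h3
  exact tendsto_nhds_unique h3 tendsto_const_nhds

/-- For any nonnegative solution `X`, the columns of `X ^ (K + 1 - k)` are harmonic in `k` and equal
the identity at the target, so they dominate the exit probabilities. -/
theorem isMinimalH_hitMatrix (h : IsRateBlocks Q₀ Q₁ Q₂ e) :
    IsMinimalH Q₀ Q₁ Q₂ (hitMatrix Q₀ Q₁ Q₂) := by
  refine ⟨⟨h.hitMatrix_nonneg, h.hitMatrix_equation⟩, fun X hX hXeq i j => ?_⟩
  refine le_of_tendsto' (h.tendsto_exitMatrix i j) fun K => ?_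
  have hpow : ∀ k i j, 0 ≤ (X ^ k) i j := by
    intro k
    induction k with
    | zero => intro i j; rw [pow_zero, Matrix.one_apply]; split_ifs <;> norm_num
    | succ k ih =>
      intro i j
      rw [pow_succ, Matrix.mul_apply]
      exact Finset.sum_nonneg fun l _ => mul_nonneg (ih i l) (hX l j)
  have := h.col_exitMatrix_le (K := K + 1) (j := j)
    (f := fun k => (X ^ (K + 1 - k)).mulVec (Pi.single j 1))
    (fun k _ i => by simpa using hpow _ i j) (by simp) ?_ (Nat.le_succ K) i
  · simpa using this
  · intro k hk hkK i
    rw [generator_eq_mulVec]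
    simp only [Matrix.mulVec_mulVec, ← Matrix.add_mulVec]
    obtain ⟨d, rfl⟩ : ∃ d, K = k + d := ⟨K - k, by omega⟩
    obtain ⟨k, rfl⟩ : ∃ k', k = k' + 1 := ⟨k - 1, by omega⟩
    have e1 : k + 1 + d + 1 - (k + 1 + 1) = d := by omega
    have e2 : k + 1 + d + 1 - (k + 1) = d + 1 := by omega
    have e3 : k + 1 + d + 1 - (k + 1 - 1) = d + 2 := by omega
    rw [e1, e2, e3]
    have : Q₀ * X ^ d + Q₁ * X ^ (d + 1) + Q₂ * X ^ (d + 2)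
        = (Q₀ + Q₁ * X + Q₂ * (X * X)) * X ^ d := by
      rw [show d + 2 = d + 1 + 1 from rfl, pow_succ' X (d + 1), pow_succ' X d]
      simp only [add_mul, mul_assoc]
    rw [this, hXeq]
    simp

/-- Maximum principle for functions harmonic at the levels strictly between `0` and `K`. -/
theorem nonpos_of_harmonic (h : IsRateBlocks Q₀ Q₁ Q₂ e) {K : ℕ} {D : ℕ → Fin n → ℝ}
    (h0 : ∀ i, D 0 i ≤ 0) (hK : ∀ i, D K i ≤ 0)
    (hD : ∀ k, 0 < k → k < K → ∀ i, generator Q₀ Q₁ Q₂ D k i = 0) :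
    ∀ k ≤ K, ∀ i, D k i ≤ 0 := by
  intro k₀ hk₀ i₀
  by_contra! hpos
  obtain ⟨⟨k₁, i₁⟩, hmem, hmax⟩ := Finset.exists_max_image
    (Finset.range (K + 1) ×ˢ (Finset.univ : Finset (Fin n))) (fun p => D p.1 p.2 / e p.2)
    ⟨(k₀, i₀), by simp; omega⟩
  set M := D k₁ i₁ / e i₁ with hM
  have hmax' : ∀ k ≤ K, ∀ i, D k i ≤ M * e i := fun k hk i => by
    have := hmax (k, i) (by simp; omega)
    exact (div_le_iff₀ (h.pos i)).1 this
  have hMpos : 0 < M := by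
    have := hmax' k₀ hk₀ i₀
    exact pos_of_mul_pos_left (hpos.trans_le this) (h.pos i₀).le
  -- Take the lowest level at which the maximum of `D / e` is attained: the level below is strictly
  -- smaller and is reached at positive rate, which contradicts harmonicity.
  have hex : ∃ k, k ≤ K ∧ ∃ i, D k i = M * e i :=
    ⟨k₁, by simp at hmem; omega, i₁, by rw [hM, div_mul_cancel₀ _ (h.pos i₁).ne']⟩
  classical
  obtain ⟨hkK, i, hi⟩ := Nat.find_spec hex
  have hmin : ∀ k', k' < Nat.find hex → ¬ (k' ≤ K ∧ ∃ i, D k' i = M * e i) :=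
    fun k' hk' => Nat.find_min hex hk'
  revert hkK hi hmin
  generalize Nat.find hex = k
  intro hkK hi hmin
  have hMe : 0 < M * e i := mul_pos hMpos (h.pos i)
  have hk0 : k ≠ 0 := by
    rintro rfl
    linarith [h0 i]
  have hkK' : k ≠ K := by
    rintro rfl
    linarith [hK i]
  have hg := hD k (Nat.pos_of_ne_zero hk0) (lt_of_le_of_ne hkK hkK') i
  have hlt : D (k - 1) i < M * e i := lt_of_le_of_ne (hmax' _ (by omega) i)
    fun hh => hmin (k - 1) (by omega) ⟨by omega, i, hh⟩
  have hstrict : generator Q₀ Q₁ Q₂ D k i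
      < ∑ l, M * (Q₀ i l * e l + Q₁ i l * e l + Q₂ i l * e l) := by
    have hw : ∀ l, Q₁ i l * D k l ≤ Q₁ i l * (M * e l) := fun l => by
      by_cases hl : l = i
      · subst hl; rw [hi]
      · exact mul_le_mul_of_nonneg_left (hmax' k hkK l) (h.within_nonneg i l hl)
    have hu : ∀ l, Q₀ i l * D (k + 1) l ≤ Q₀ i l * (M * e l) := fun l =>
      mul_le_mul_of_nonneg_left (hmax' _ (by omega) l) (h.up_nonneg i l)
    refine Finset.sum_lt_sum (fun l _ => ?_) ⟨i, Finset.mem_univ i, ?_⟩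
    · have := mul_le_mul_of_nonneg_left (hmax' (k - 1) (by omega) l) (h.down_nonneg i l)
      linarith [hw l, hu l]
    · have := mul_lt_mul_of_pos_left hlt (h.down_diag_pos i)
      linarith [hw i, hu i]
  rw [← Finset.mul_sum, h.harmonic i, mul_zero] at hstrict
  linarith

/-- The harmonic function `z ^ (K - k) • w` agrees with the exit average of `w` at level `K` and
differs from it at level `0` only by `z ^ K • w`. The maximum principle keeps the error below `z ^ K
* C * e`, which vanishes in the limit as `z < 1`. -/
theorem hitMatrix_mulVec (h : IsRateBlocks Q₀ Q₁ Q₂ e) {z : ℝ} (hz0 : 0 < z) (hz1 : z < 1)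
    {w : Fin n → ℝ} (hw : ∀ i, 0 < w i)
    (heq : Q₀.mulVec w + z • Q₁.mulVec w + z ^ 2 • Q₂.mulVec w = 0) :
    (hitMatrix Q₀ Q₁ Q₂).mulVec w = z • w := by
  set F : ℕ → ℕ → Fin n → ℝ := fun K k => z ^ (K - k) • w with hF
  have hgen : ∀ K k, 0 < k → k < K → ∀ i, generator Q₀ Q₁ Q₂ (F K) k i = 0 := by
    intro K k hk hkK i
    rw [generator_eq_mulVec]
    obtain ⟨k, rfl⟩ : ∃ k', k = k' + 1 := ⟨k - 1, by omega⟩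
    obtain ⟨d, rfl⟩ : ∃ d, K = k + 1 + 1 + d := ⟨K - (k + 1 + 1), by omega⟩
    have e1 : k + 1 + 1 + d - (k + 1 + 1) = d := by omega
    have e2 : k + 1 + 1 + d - (k + 1) = d + 1 := by omega
    have e3 : k + 1 + 1 + d - (k + 1 - 1) = d + 2 := by omega
    simp only [hF, e1, e2, e3, Matrix.mulVec_smul]
    have : z ^ d • Q₀.mulVec w + z ^ (d + 1) • Q₁.mulVec w + z ^ (d + 2) • Q₂.mulVec w
        = z ^ d • (Q₀.mulVec w + z • Q₁.mulVec w + z ^ 2 • Q₂.mulVec w) := by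
      simp only [smul_add, smul_smul]
      rw [pow_succ, pow_add]
    rw [this, heq]
    simp
  obtain ⟨C, hC⟩ : ∃ C, ∀ i, w i ≤ C * e i := by
    refine ⟨∑ i, w i / e i, fun i => ?_⟩
    rw [← div_le_iff₀ (h.pos i)]
    exact Finset.single_le_sum (f := fun i => w i / e i)
      (fun l _ => (div_pos (hw l) (h.pos l)).le) (Finset.mem_univ i)
  ext i
  have hlim : Tendsto (fun K => (exitMatrix Q₀ Q₁ Q₂ K (K + 1)).mulVec w i) atTop
      (𝓝 ((hitMatrix Q₀ Q₁ Q₂).mulVec w i)) := by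
    simp only [Matrix.mulVec, dotProduct]
    exact tendsto_finsetSum _ fun j _ => (h.tendsto_exitMatrix i j).mul_const _
  refine le_antisymm (le_of_tendsto' hlim fun K => ?_) ?_
  · have := h.exitMatrix_mulVec_le (K := K + 1) (c := w) (f := F (K + 1))
      (fun k _ i => mul_nonneg (pow_nonneg hz0.le _) (hw i).le) (fun i => by simp [hF])
      (fun k hk hkK i => (hgen _ k hk hkK i).le) (Nat.le_succ K) i
    simpa [hF] using this
  · have hlow : ∀ K, z * w i - z ^ (K + 1) * C * e i
        ≤ (exitMatrix Q₀ Q₁ Q₂ K (K + 1)).mulVec w i := by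
      intro K
      have hMe : ∀ k i, generator Q₀ Q₁ Q₂ (fun _ i => z ^ (K + 1) * C * e i) k i = 0 := by
        intro k i
        have := congrArg (fun x => z ^ (K + 1) * C * x) (h.harmonic i)
        simp only [Finset.mul_sum, mul_zero] at this
        rw [← this, generator]
        exact Finset.sum_congr rfl fun l _ => by ring
      have hz : 0 < z ^ (K + 1) := pow_pos hz0 _
      have := h.nonpos_of_harmonic (K := K + 1)
        (D := fun k i => F (K + 1) k i - (exitMatrix Q₀ Q₁ Q₂ k (K + 1)).mulVec w i
          - z ^ (K + 1) * C * e i) ?_ ?_ ?_ K (Nat.le_succ K) i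
      · simp [hF] at this
        linarith
      · intro i
        rw [exitMatrix_zero _ _ _ (Nat.succ_pos K)]
        simp only [hF, Matrix.zero_mulVec, Pi.smul_apply, smul_eq_mul, Pi.zero_apply,
          Nat.sub_zero, sub_zero]
        nlinarith [hC i]
      · intro i
        rw [exitMatrix_self]
        simp only [hF, Matrix.one_mulVec, Pi.smul_apply, smul_eq_mul, Nat.sub_self, pow_zero,
          one_mul, sub_self, zero_sub]
        have := mul_pos hz ((hw i).trans_le (hC i))
        linarith
      · intro k hk hkK i
        rw [generator_sub (fun k i => F (K + 1) k i
          - (exitMatrix Q₀ Q₁ Q₂ k (K + 1)).mulVec w i), generator_sub, hMe,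
          hgen _ k hk hkK, h.generator_exitMatrix hk hkK]
        simp
    have hlim2 : Tendsto (fun K : ℕ => z * w i - z ^ (K + 1) * C * e i) atTop
        (𝓝 (z * w i - 0 * C * e i)) :=
      tendsto_const_nhds.sub ((((tendsto_add_atTop_iff_nat 1).2
        (tendsto_pow_atTop_nhds_zero_of_lt_one hz0.le hz1)).mul_const C).mul_const _)
    have := le_of_tendsto_of_tendsto' hlim2 hlim hlow
    simpa using this

end IsRateBlocks

/-! ### Maximal eigenvalues and transposition -/

/-- A positive eigenvector of a nonnegative matrix belongs to the maximal eigenvalue. -/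
theorem isMaximalEigenvalue_of_pos {A : Matrix (Fin n) (Fin n) ℝ} (hA : ∀ i j, 0 ≤ A i j)
    {w : Fin n → ℝ} (hw : ∀ i, 0 < w i) (hn : 0 < n) {z : ℝ} (hz : A.mulVec w = z • w) :
    IsMaximalEigenvalue A z := by
  constructor
  · refine Module.End.hasEigenvalue_of_hasEigenvector (x := w) ⟨?_, fun h0 => ?_⟩
    · rw [Module.End.mem_eigenspace_iff]
      simpa using hz
    · have := hw ⟨0, hn⟩
      rw [h0] at this
      exact lt_irrefl _ this
  · intro c hc
    obtain ⟨u, hu, hu0⟩ := hc.exists_hasEigenvector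
    rw [Module.End.mem_eigenspace_iff] at hu
    -- Compare in the norm weighted by `w`: at a phase maximizing `‖u‖ / w` the eigenvalue equation
    -- gives `‖c‖ ≤ z`.
    obtain ⟨i, -, hi⟩ := Finset.exists_max_image Finset.univ (fun i => ‖u i‖ / w i)
      ⟨⟨0, hn⟩, Finset.mem_univ _⟩
    have hi' : ∀ l, ‖u l‖ ≤ ‖u i‖ / w i * w l := fun l =>
      (div_le_iff₀ (hw l)).1 (hi l (Finset.mem_univ l))
    have hui : 0 < ‖u i‖ := by
      by_contra! hle
      have h0 : ‖u i‖ = 0 := le_antisymm hle (norm_nonneg _)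
      refine hu0 (funext fun l => ?_)
      have := hi' l
      rw [h0, zero_div, zero_mul] at this
      exact norm_le_zero_iff.1 this
    have h1 : ∑ l, (A i l : ℂ) * u l = c * u i := by
      have := congrFun hu i
      simpa [Matrix.mulVec, dotProduct] using this
    have h2 : ‖c‖ * ‖u i‖ ≤ z * ‖u i‖ := by
      calc ‖c‖ * ‖u i‖ = ‖∑ l, (A i l : ℂ) * u l‖ := by rw [h1, norm_mul]
        _ ≤ ∑ l, ‖(A i l : ℂ) * u l‖ := norm_sum_le _ _
        _ ≤ ∑ l, ‖u i‖ / w i * (A i l * w l) := Finset.sum_le_sum fun l _ => by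
            rw [norm_mul, Complex.norm_real, Real.norm_of_nonneg (hA i l)]
            have := mul_le_mul_of_nonneg_left (hi' l) (hA i l)
            linarith
        _ = ‖u i‖ / w i * (z * w i) := by
            rw [← Finset.mul_sum]
            congr 1
            exact congrFun hz i
        _ = z * ‖u i‖ := by
            have := (hw i).ne'
            field_simp
    exact le_of_mul_le_mul_right h2 hui

theorem IsMaximalEigenvalue.transpose {A : Matrix (Fin n) (Fin n) ℝ} {z : ℝ}
    (h : IsMaximalEigenvalue A z) : IsMaximalEigenvalue A.transpose z := by
  simp only [IsMaximalEigenvalue, Module.End.hasEigenvalue_iff_isRoot_charpoly,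
    Matrix.charpoly_toLin', Matrix.transpose_map, Matrix.charpoly_transpose] at h ⊢
  exact h

/-- Transposition reverses products and preserves the entrywise order, so it carries the equation
for `H` and its minimality to those for `R`. -/
theorem IsMinimalH.transpose {X : Matrix (Fin n) (Fin n) ℝ}
    (h : IsMinimalH Q₀.transpose Q₁.transpose Q₂.transpose X) :
    IsMinimalR Q₀ Q₁ Q₂ X.transpose := by
  refine ⟨⟨fun i j => h.1.1 j i, ?_⟩, fun Y hY hYeq i j => ?_⟩
  · have := congrArg Matrix.transpose h.1.2
    simpa [Matrix.transpose_mul, mul_assoc] using this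
  · refine h.2 Y.transpose (fun i j => hY j i) ?_ j i
    have := congrArg Matrix.transpose hYeq
    simpa [Matrix.transpose_mul, mul_assoc] using this

end GeneralQBD

/-! ### The polynomials and positive supersolutions -/

section Polynomials

variable {lam μ₁ μ₂ : ℝ}

theorem P_add_two (lam μ₁ μ₂ z : ℝ) (n : ℕ) (x : ℝ) :
    P lam μ₁ μ₂ z (n + 2) x = z / μ₁ * ((x + lam + μ₁ + μ₂ * (1 - z)) * P lam μ₁ μ₂ z (n + 1) x
      - lam * P lam μ₁ μ₂ z n x) := rfl

theorem P_one (lam μ₁ μ₂ z x : ℝ) :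
    P lam μ₁ μ₂ z 1 x = z / μ₁ * (x + lam + μ₂ * (1 - z)) := rfl

theorem P_zero (lam μ₁ μ₂ z x : ℝ) : P lam μ₁ μ₂ z 0 x = 1 := rfl

theorem Phat_succ (lam μ₁ μ₂ z : ℝ) (n : ℕ) (x : ℝ) :
    Phat lam μ₁ μ₂ z (n + 1) x
      = P lam μ₁ μ₂ z (n + 1) x - lam * z / μ₁ * P lam μ₁ μ₂ z n x := rfl

theorem continuous_P (lam μ₁ μ₂ : ℝ) :
    ∀ n, Continuous fun p : ℝ × ℝ => P lam μ₁ μ₂ p.1 n p.2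
  | 0 => by simp only [P_zero]; exact continuous_const
  | 1 => by simp only [P_one]; fun_prop
  | n + 2 => by
    have h1 := continuous_P lam μ₁ μ₂ (n + 1)
    have h2 := continuous_P lam μ₁ μ₂ n
    simp only [P_add_two]
    fun_prop

theorem continuous_Phat_succ (lam μ₁ μ₂ : ℝ) (n : ℕ) :
    Continuous fun p : ℝ × ℝ => Phat lam μ₁ μ₂ p.1 (n + 1) p.2 := by
  have h1 := continuous_P lam μ₁ μ₂ (n + 1)
  have h2 := continuous_P lam μ₁ μ₂ n
  simp only [Phat_succ]
  fun_prop

/-- The recursively defined eigenvector candidate for the eigenvalue `x` is positive and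
is a supersolution at the last phase. -/
def IsSuper (lam μ₁ μ₂ : ℝ) (m : ℕ) (p : ℝ × ℝ) : Prop :=
  (∀ n ≤ m, 0 < P lam μ₁ μ₂ p.1 n p.2) ∧ 0 ≤ Phat lam μ₁ μ₂ p.1 (m + 1) p.2

/-- In `IsSuper` positivity can be weakened to nonnegativity. -/
theorem isSuper_of_nonneg (hlam : 0 < lam) (hμ₁ : 0 < μ₁) {m : ℕ} {p : ℝ × ℝ} (hz : 0 < p.1)
    (hP : ∀ n ≤ m, 0 ≤ P lam μ₁ μ₂ p.1 n p.2) (hhat : 0 ≤ Phat lam μ₁ μ₂ p.1 (m + 1) p.2) :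
    IsSuper lam μ₁ μ₂ m p := by
  refine ⟨fun n => ?_, hhat⟩
  induction n with
  | zero => intro _; rw [P_zero]; exact one_pos
  | succ n ih =>
    intro hn
    refine lt_of_le_of_ne (hP _ hn) fun h0 => ?_
    have hneg : P lam μ₁ μ₂ p.1 (n + 2) p.2 < 0 := by
      rw [P_add_two, ← h0, mul_zero, zero_sub]
      have := mul_pos hlam (ih (by omega))
      exact mul_neg_of_pos_of_neg (div_pos hz hμ₁) (by linarith)
    rcases Nat.lt_or_ge (n + 1) m with hlt | hge
    · exact absurd (hP (n + 2) hlt) (not_le.2 hneg)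
    · obtain rfl : m = n + 1 := by omega
      rw [Phat_succ, ← h0, mul_zero, sub_zero] at hhat
      exact absurd hhat (not_le.2 hneg)

theorem isClosed_setOf_nonneg (lam μ₁ μ₂ : ℝ) (m : ℕ) :
    IsClosed {p : ℝ × ℝ | (∀ n ≤ m, 0 ≤ P lam μ₁ μ₂ p.1 n p.2) ∧
      0 ≤ Phat lam μ₁ μ₂ p.1 (m + 1) p.2} := by
  refine IsClosed.inter ?_ (isClosed_le continuous_const (continuous_Phat_succ lam μ₁ μ₂ m))
  have : {p : ℝ × ℝ | ∀ n ≤ m, 0 ≤ P lam μ₁ μ₂ p.1 n p.2}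
      = ⋂ n ∈ Set.Iic m, {p : ℝ × ℝ | 0 ≤ P lam μ₁ μ₂ p.1 n p.2} := by
    ext p; simp
  change IsClosed {p : ℝ × ℝ | ∀ n ≤ m, 0 ≤ P lam μ₁ μ₂ p.1 n p.2}
  rw [this]
  exact isClosed_biInter fun n _ => isClosed_le continuous_const (continuous_P lam μ₁ μ₂ n)

theorem IsSuper.eventually {m : ℕ} {p : ℝ × ℝ} (h : IsSuper lam μ₁ μ₂ m p)
    (hpos : 0 < Phat lam μ₁ μ₂ p.1 (m + 1) p.2) : ∀ᶠ q in 𝓝 p, IsSuper lam μ₁ μ₂ m q := by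
  have h1 : ∀ᶠ q in 𝓝 p, ∀ n ∈ Set.Iic m, 0 < P lam μ₁ μ₂ q.1 n q.2 :=
    (Filter.eventually_all_finite (Set.finite_Iic m)).2 fun n hn =>
      (continuous_P lam μ₁ μ₂ n).continuousAt.eventually_const_lt (h.1 n hn)
  have h2 := (continuous_Phat_succ lam μ₁ μ₂ m).continuousAt.eventually_const_lt hpos
  filter_upwards [h1, h2] with q hq1 hq2
  exact ⟨hq1, hq2.le⟩

/-- For large `x` the polynomials grow geometrically. -/
theorem exists_isSuper (hlam : 0 < lam) (hμ₁ : 0 < μ₁) (hμ₂ : 0 < μ₂) {z : ℝ} (hz0 : 0 < z)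
    (hz1 : z < 1) (m : ℕ) : ∃ x, 0 ≤ x ∧ IsSuper lam μ₁ μ₂ m (z, x) := by
  -- `x` is chosen so that `z / μ₁ * x = K`, which makes each `P` at least `K` times the previous
  -- one. The summand `1` gives monotonicity, the summand `lam * z / μ₁` gives `Phat ≥ 0`.
  set K := 1 + lam * z / μ₁ with hK
  have hr : 0 < lam * z / μ₁ := by positivity
  have hc : 0 < μ₂ * (1 - z) := mul_pos hμ₂ (by linarith)
  have hx : 0 ≤ K * μ₁ / z := by positivity
  have hzx : z / μ₁ * (K * μ₁ / z) = K := by field_simp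
  have hzm : 0 < z / μ₁ := div_pos hz0 hμ₁
  refine ⟨K * μ₁ / z, hx, ?_⟩
  generalize K * μ₁ / z = x at hx hzx
  have key : ∀ n, 0 < P lam μ₁ μ₂ z n x ∧ K * P lam μ₁ μ₂ z n x ≤ P lam μ₁ μ₂ z (n + 1) x := by
    intro n
    induction n with
    | zero =>
      rw [P_zero, P_one]
      refine ⟨one_pos, ?_⟩
      have : 0 < z / μ₁ * (lam + μ₂ * (1 - z)) := by positivity
      linarith
    | succ n ih =>
      obtain ⟨h1, h2⟩ := ih
      have h3 : P lam μ₁ μ₂ z n x ≤ P lam μ₁ μ₂ z (n + 1) x := by nlinarith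
      have h4 : 0 < P lam μ₁ μ₂ z (n + 1) x := h1.trans_le h3
      refine ⟨h4, ?_⟩
      rw [P_add_two]
      have h5 : 0 ≤ z / μ₁ * (lam * (P lam μ₁ μ₂ z (n + 1) x - P lam μ₁ μ₂ z n x)) := by
        have := sub_nonneg.2 h3
        positivity
      have h6 : 0 ≤ z / μ₁ * ((μ₁ + μ₂ * (1 - z)) * P lam μ₁ μ₂ z (n + 1) x) := by positivity
      have h7 : z / μ₁ * x * P lam μ₁ μ₂ z (n + 1) x = K * P lam μ₁ μ₂ z (n + 1) x := by rw [hzx]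
      linarith
  refine ⟨fun n _ => (key n).1, ?_⟩
  simp only [Phat_succ]
  have h1 := (key m).1
  have h2 := (key m).2
  rw [hK] at h2
  linarith

/-- If `0` is the largest zero, then the eigenvector candidate for the eigenvalue `0` is
positive. -/
theorem IsLargestZero.isSuper (hlam : 0 < lam) (hμ₁ : 0 < μ₁) (hμ₂ : 0 < μ₂) {z : ℝ} (hz0 : 0 < z)
    (hz1 : z < 1) {m : ℕ} (h : IsLargestZero lam μ₁ μ₂ z (m + 1) 0) :
    IsSuper lam μ₁ μ₂ m (z, 0) := by
  obtain ⟨X, hX0, hX⟩ := exists_isSuper hlam hμ₁ hμ₂ hz0 hz1 m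
  have hcl : IsClosed {x : ℝ | (∀ n ≤ m, 0 ≤ P lam μ₁ μ₂ z n x) ∧
      0 ≤ Phat lam μ₁ μ₂ z (m + 1) x} :=
    (isClosed_setOf_nonneg lam μ₁ μ₂ m).preimage (f := fun x : ℝ => ((z, x) : ℝ × ℝ))
      (by fun_prop)
  -- At the least `x ≥ 0` with `IsSuper`, either `x = 0`, or `Phat = 0` at a positive `x`, or
  -- `IsSuper` persists slightly to the left; the last two are impossible.
  obtain ⟨x, ⟨hxI, hx⟩, hmin⟩ := (isCompact_Icc.inter_right hcl).exists_isLeast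
    ⟨X, (⟨hX0, le_rfl⟩ : X ∈ Set.Icc 0 X), ⟨fun n hn => (hX.1 n hn).le, hX.2⟩⟩
  have hs : IsSuper lam μ₁ μ₂ m (z, x) := isSuper_of_nonneg hlam hμ₁ hz0 hx.1 hx.2
  rcases hxI.1.eq_or_lt with rfl | hpos
  · exact hs
  exfalso
  rcases hs.2.eq_or_lt with h0 | hlt
  · exact absurd (h.2 h0.symm) (not_le.2 hpos)
  · have h1 : ∀ᶠ y in 𝓝 x, IsSuper lam μ₁ μ₂ m (z, y) :=
      (by fun_prop : Continuous fun y : ℝ => ((z, y) : ℝ × ℝ)).continuousAt.eventually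
        (hs.eventually hlt)
    obtain ⟨y, hy, hy0, hyx⟩ := ((h1.filter_mono nhdsWithin_le_nhds).and
      (Ioo_mem_nhdsLT hpos)).exists
    have := hmin ⟨⟨hy0.le, hyx.le.trans hxI.2⟩, fun n hn => (hy.1 n hn).le, hy.2⟩
    linarith

/-! ### The phase operator: comparison and uniqueness of the root -/

/-- The matrix `z⁻¹ Q₀ + Q₁ + z Q₂` applied to a vector. -/
noncomputable def phaseOp (lam μ₁ μ₂ : ℝ) (m : ℕ) (z : ℝ) (v : ℕ → ℝ) (i : ℕ) : ℝ :=
  (if i < m then lam * (v (i + 1) - v i) else 0)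
    + (if 0 < i then μ₁ * (v (i - 1) / z - v i) else 0) - μ₂ * (1 - z) * v i

/-- A positive strict supersolution excludes eigenvectors with a positive entry. -/
theorem nonpos_of_strict_super (hlam : 0 < lam) (hμ₁ : 0 < μ₁) {m : ℕ} {z : ℝ} (hz0 : 0 < z)
    {u w : ℕ → ℝ} {y : ℝ} (hu : ∀ i ≤ m, 0 < u i)
    (hlt : ∀ i ≤ m, phaseOp lam μ₁ μ₂ m z u i < y * u i)
    (hw : ∀ i ≤ m, phaseOp lam μ₁ μ₂ m z w i = y * w i) : ∀ i ≤ m, w i ≤ 0 := by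
  intro i₀ hi₀
  by_contra! hpos
  obtain ⟨i, him, hi⟩ := Finset.exists_max_image (Finset.range (m + 1)) (fun i => w i / u i)
    ⟨i₀, by simp; omega⟩
  have him' : i ≤ m := by simp at him; omega
  set M := w i / u i with hM
  have hle : ∀ l ≤ m, w l ≤ M * u l := fun l hl =>
    (div_le_iff₀ (hu l hl)).1 (hi l (by simp; omega))
  have hMpos : 0 < M := pos_of_mul_pos_left (hpos.trans_le (hle i₀ hi₀)) (hu i₀ hi₀).le
  have hwi : w i = M * u i := by rw [hM, div_mul_cancel₀ _ (hu i him').ne']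
  have h1 : phaseOp lam μ₁ μ₂ m z w i ≤ M * phaseOp lam μ₁ μ₂ m z u i := by
    have hA : (if i < m then lam * (w (i + 1) - w i) else 0)
        ≤ M * (if i < m then lam * (u (i + 1) - u i) else 0) := by
      split_ifs with h
      · have := mul_le_mul_of_nonneg_left (hle (i + 1) h) hlam.le
        rw [hwi]; linarith
      · simp
    have hB : (if 0 < i then μ₁ * (w (i - 1) / z - w i) else 0)
        ≤ M * (if 0 < i then μ₁ * (u (i - 1) / z - u i) else 0) := by
      split_ifs with h
      · have h2 : w (i - 1) / z ≤ M * u (i - 1) / z :=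
          div_le_div_of_nonneg_right (hle (i - 1) (by omega)) hz0.le
        have := mul_le_mul_of_nonneg_left h2 hμ₁.le
        rw [hwi]
        calc _ ≤ μ₁ * (M * u (i - 1) / z) - μ₁ * (M * u i) := by linarith
          _ = _ := by ring
      · simp
    rw [phaseOp, phaseOp, hwi] at *
    linarith
  rw [hw i him', hwi] at h1
  have := mul_lt_mul_of_pos_left (hlt i him') hMpos
  linarith

/-- The eigenvector candidate of `z⁻¹ Q₀ + Q₁ + z Q₂` for the eigenvalue `x`. -/
noncomputable def phaseVec (lam μ₁ μ₂ z x : ℝ) (n : ℕ) : ℝ :=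
  (μ₁ / (lam * z)) ^ n * P lam μ₁ μ₂ z n x

theorem phaseOp_phaseVec (hlam : 0 < lam) (hμ₁ : 0 < μ₁) {m : ℕ} {z x : ℝ} (hz0 : 0 < z)
    (h : Phat lam μ₁ μ₂ z (m + 1) x = 0) {i : ℕ} (hi : i ≤ m) :
    phaseOp lam μ₁ μ₂ m z (phaseVec lam μ₁ μ₂ z x) i = x * phaseVec lam μ₁ μ₂ z x i := by
  -- `Phat = 0` says that the candidate takes equal values at `m` and `m + 1`, so the missing
  -- arrival term at phase `m` can be added freely.
  have h0 : lam * (phaseVec lam μ₁ μ₂ z x (m + 1) - phaseVec lam μ₁ μ₂ z x m) = 0 := by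
    have : phaseVec lam μ₁ μ₂ z x (m + 1) - phaseVec lam μ₁ μ₂ z x m
        = (μ₁ / (lam * z)) ^ (m + 1) * Phat lam μ₁ μ₂ z (m + 1) x := by
      rw [phaseVec, phaseVec, Phat_succ, pow_succ]
      field_simp
    rw [this, h, mul_zero, mul_zero]
  have h1 : (if i < m then
      lam * (phaseVec lam μ₁ μ₂ z x (i + 1) - phaseVec lam μ₁ μ₂ z x i) else 0)
      = lam * (phaseVec lam μ₁ μ₂ z x (i + 1) - phaseVec lam μ₁ μ₂ z x i) := by
    split_ifs with hlt
    · rfl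
    · obtain rfl : i = m := by omega
      exact h0.symm
  rw [phaseOp, h1]
  rcases i with _ | i
  · simp only [phaseVec, P_zero, zero_add, P_one, lt_irrefl, if_false]
    field_simp
    ring
  · simp only [phaseVec, Nat.succ_pos, if_true, Nat.add_sub_cancel, P_add_two]
    rw [pow_succ, pow_succ]
    field_simp
    ring

theorem IsSuper.phaseVec_pos (hlam : 0 < lam) (hμ₁ : 0 < μ₁) {m : ℕ} {z x : ℝ} (hz0 : 0 < z)
    (h : IsSuper lam μ₁ μ₂ m (z, x)) : ∀ i ≤ m, 0 < phaseVec lam μ₁ μ₂ z x i := fun i hi =>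
  mul_pos (pow_pos (div_pos hμ₁ (mul_pos hlam hz0)) i) (h.1 i hi)

/-- The positive null vector is a strict supersolution for every `x > 0`, whereas a zero `x` of
`Phat` would give an eigenvector with entry `1` at phase `0`. -/
theorem IsSuper.isLargestZero (hlam : 0 < lam) (hμ₁ : 0 < μ₁) {m : ℕ} {z : ℝ} (hz0 : 0 < z)
    (h : IsSuper lam μ₁ μ₂ m (z, 0)) (h0 : Phat lam μ₁ μ₂ z (m + 1) 0 = 0) :
    IsLargestZero lam μ₁ μ₂ z (m + 1) 0 := by
  refine ⟨h0, fun x hx => ?_⟩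
  by_contra! hpos
  have hvpos := h.phaseVec_pos hlam hμ₁ hz0
  have := nonpos_of_strict_super hlam hμ₁ hz0 (u := phaseVec lam μ₁ μ₂ z 0) (y := x) hvpos
    (fun i hi => by
      rw [phaseOp_phaseVec hlam hμ₁ hz0 h0 hi, zero_mul]
      exact mul_pos hpos (hvpos i hi))
    (fun i hi => phaseOp_phaseVec hlam hμ₁ hz0 hx hi) 0 (Nat.zero_le m)
  simp [phaseVec, P_zero] at this
  linarith

theorem rpow_le_one_add {t θ : ℝ} (ht : 0 ≤ t) (h0 : 0 < θ) (h1 : θ < 1) :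
    t ^ θ ≤ 1 + θ * (t - 1) := by
  have := rpow_one_add_le_one_add_mul_self (s := t - 1) (by linarith) h0.le h1.le
  simpa using this

/-- The root is unique, by strict log-convexity in `z` of the maximal eigenvalue of
`z⁻¹ Q₀ + Q₁ + z Q₂`. -/
theorem not_lt_of_isSuper (hlam : 0 < lam) (hμ₁ : 0 < μ₁) (hμ₂ : 0 < μ₂) {m : ℕ} {y z : ℝ}
    (hy0 : 0 < y) (hz1 : z < 1) (hy : IsSuper lam μ₁ μ₂ m (y, 0))
    (hy' : Phat lam μ₁ μ₂ y (m + 1) 0 = 0)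
    (hz' : Phat lam μ₁ μ₂ z (m + 1) 0 = 0) : ¬ y < z := by
  intro hyz
  have hz0 := hy0.trans hyz
  set V := phaseVec lam μ₁ μ₂ y 0 with hV
  have hVpos : ∀ i ≤ m, 0 < V i := hy.phaseVec_pos hlam hμ₁ hy0
  have hly : Real.log y < 0 := Real.log_neg hy0 (hyz.trans hz1)
  have hlz : Real.log z < 0 := Real.log_neg hz0 hz1
  -- With `z = y ^ θ` and `0 < θ < 1`, the vector `V ^ θ` is the trial supersolution at `z`; it
  -- interpolates geometrically between `V` at `y` and the constant vector at `1`.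
  set θ := Real.log z / Real.log y with hθ
  have hθ0 : 0 < θ := div_pos_of_neg_of_neg hlz hly
  have hθ1 : θ < 1 := by
    rw [hθ, div_lt_one_of_neg hly]
    exact Real.log_lt_log hy0 hyz
  have hyθ : y ^ θ = z := by
    rw [Real.rpow_def_of_pos hy0, hθ, mul_div_cancel₀ _ hly.ne, Real.exp_log hz0]
  -- Strict Bernoulli in the killing term supplies the strictness; the arrival and up terms need
  -- only the weak form `hratio`.
  have hzlt : z < 1 + θ * (y - 1) := by
    have := rpow_one_add_lt_one_add_mul_self (s := y - 1) (by linarith) (by linarith) hθ0 hθ1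
    rw [← hyθ]
    simpa using this
  have hratio : ∀ a b : ℝ, 0 < a → 0 < b → a ^ θ ≤ b ^ θ * (1 + θ * (a / b - 1)) := by
    intro a b ha hb
    have h1 := rpow_le_one_add (div_pos ha hb).le hθ0 hθ1
    rw [Real.div_rpow ha.le hb.le, div_le_iff₀ (Real.rpow_pos_of_pos hb θ)] at h1
    linarith
  have := nonpos_of_strict_super hlam hμ₁ hz0 (u := fun i => V i ^ θ) (y := 0)
    (fun i hi => Real.rpow_pos_of_pos (hVpos i hi) θ) (fun i hi => ?_)
    (fun i hi => phaseOp_phaseVec hlam hμ₁ hz0 hz' hi) 0 (Nat.zero_le m)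
  · simp [phaseVec, P_zero] at this
    linarith
  · have hVi := hVpos i hi
    have ht : 0 < V i ^ θ := Real.rpow_pos_of_pos hVi θ
    have hop : phaseOp lam μ₁ μ₂ m y V i = 0 := by
      rw [hV, phaseOp_phaseVec hlam hμ₁ hy0 hy' hi, zero_mul]
    have hA : (if i < m then lam * (V (i + 1) ^ θ - V i ^ θ) else 0)
        ≤ V i ^ θ * θ / V i * (if i < m then lam * (V (i + 1) - V i) else 0) := by
      split_ifs with h
      · have h1 := mul_le_mul_of_nonneg_left (hratio (V (i + 1)) (V i) (hVpos _ h) hVi) hlam.le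
        calc _ ≤ lam * (V i ^ θ * (1 + θ * (V (i + 1) / V i - 1))) - lam * V i ^ θ := by linarith
          _ = _ := by field_simp; ring
      · simp
    have hB : (if 0 < i then μ₁ * (V (i - 1) ^ θ / z - V i ^ θ) else 0)
        ≤ V i ^ θ * θ / V i * (if 0 < i then μ₁ * (V (i - 1) / y - V i) else 0) := by
      split_ifs with h
      · have h1 := hratio (V (i - 1) / y) (V i) (div_pos (hVpos _ (by omega)) hy0) hVi
        rw [Real.div_rpow (hVpos _ (by omega)).le hy0.le, hyθ] at h1
        have h2 := mul_le_mul_of_nonneg_left h1 hμ₁.le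
        calc _ ≤ μ₁ * (V i ^ θ * (1 + θ * (V (i - 1) / y / V i - 1))) - μ₁ * V i ^ θ := by
              linarith
          _ = _ := by field_simp; ring
      · simp
    have hC : - (μ₂ * (1 - z) * V i ^ θ) < V i ^ θ * θ / V i * (- (μ₂ * (1 - y) * V i)) := by
      have h1 : V i ^ θ * θ / V i * (- (μ₂ * (1 - y) * V i)) = μ₂ * (V i ^ θ) * (θ * (y - 1)) := by
        field_simp; ring
      rw [h1]
      have := mul_lt_mul_of_pos_left hzlt (mul_pos hμ₂ ht)
      linarith
    have hsum : phaseOp lam μ₁ μ₂ m z (fun i => V i ^ θ) i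
        < V i ^ θ * θ / V i * phaseOp lam μ₁ μ₂ m y V i := by
      simp only [phaseOp]
      linarith
    rwa [hop, mul_zero, ← zero_mul (V i ^ θ)] at hsum

theorem eq_of_isSuper (hlam : 0 < lam) (hμ₁ : 0 < μ₁) (hμ₂ : 0 < μ₂) {m : ℕ} {y z : ℝ}
    (hyI : y ∈ Set.Ioo (0 : ℝ) 1) (hzI : z ∈ Set.Ioo (0 : ℝ) 1)
    (hy : IsSuper lam μ₁ μ₂ m (y, 0)) (hy' : Phat lam μ₁ μ₂ y (m + 1) 0 = 0)
    (hz : IsSuper lam μ₁ μ₂ m (z, 0)) (hz' : Phat lam μ₁ μ₂ z (m + 1) 0 = 0) : y = z :=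
  le_antisymm (not_lt.1 (not_lt_of_isSuper hlam hμ₁ hμ₂ hzI.1 hyI.2 hz hz' hy'))
    (not_lt.1 (not_lt_of_isSuper hlam hμ₁ hμ₂ hyI.1 hzI.2 hy hy' hz'))

/-- The last two entries bound each other: `Phat ≥ 0` gives `lam * P (m - 1) ≤ (μ₁ + μ₂) * P m`, and
the recursion bounds `μ₁ * P m` by `z * (lam + μ₁ + μ₂) * P (m - 1)`. This keeps the minimization
over `z` away from `0`; for `m = 0` every `z` in `(0, 1)` qualifies. -/
theorem IsSuper.lower_bound (hlam : 0 < lam) (hμ₁ : 0 < μ₁) (hμ₂ : 0 < μ₂) {m : ℕ} (hm : 1 ≤ m)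
    {z : ℝ} (hz0 : 0 < z) (h : IsSuper lam μ₁ μ₂ m (z, 0)) :
    lam * μ₁ / ((μ₁ + μ₂) * (lam + μ₁ + μ₂)) ≤ z := by
  obtain ⟨m, rfl⟩ : ∃ m', m = m' + 1 := ⟨m - 1, by omega⟩
  have ha := h.1 m (Nat.le_succ m)
  have hb := h.1 (m + 1) le_rfl
  have h1 := h.2
  simp only [Phat_succ, P_add_two] at h1 ha hb
  set a := P lam μ₁ μ₂ z m 0 with hadef
  set b := P lam μ₁ μ₂ z (m + 1) 0 with hbdef
  have hzm : 0 < z / μ₁ := div_pos hz0 hμ₁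
  have hc : 0 < μ₂ * z := mul_pos hμ₂ hz0
  have hba : μ₁ * b ≤ z * ((lam + μ₁ + μ₂) * a) := by
    have : b ≤ z / μ₁ * ((lam + μ₁ + μ₂) * a) := by
      rcases m with _ | m
      · rw [hbdef, zero_add, P_one, hadef, P_zero]
        exact mul_le_mul_of_nonneg_left (by linarith) hzm.le
      · have hp := h.1 m (by omega)
        simp only at hp
        rw [hbdef, P_add_two, ← hadef]
        refine mul_le_mul_of_nonneg_left ?_ hzm.le
        have := mul_pos hlam hp
        have := mul_pos hc ha
        linarith
    calc μ₁ * b ≤ μ₁ * (z / μ₁ * ((lam + μ₁ + μ₂) * a)) := mul_le_mul_of_nonneg_left this hμ₁.le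
      _ = _ := by field_simp
  have hab : lam * a ≤ (μ₁ + μ₂) * b := by
    have h2 : z / μ₁ * ((μ₁ + μ₂ * (1 - z)) * b - lam * a) ≥ 0 := by
      calc _ = _ := by ring
        _ ≥ _ := h1
    have h3 := nonneg_of_mul_nonneg_right h2 hzm
    nlinarith [mul_pos hc hb]
  rw [div_le_iff₀ (by positivity)]
  refine le_of_mul_le_mul_right ?_ ha
  have e1 := mul_le_mul_of_nonneg_left hab hμ₁.le
  have e2 := mul_le_mul_of_nonneg_left hba (add_pos hμ₁ hμ₂).le
  linarith

/-- The least `z` admitting a positive supersolution is the root. -/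
theorem exists_isLeast_isSuper (hlam : 0 < lam) (hμ₁ : 0 < μ₁) (hμ₂ : 0 < μ₂) {m : ℕ} (hm : 1 ≤ m)
    (hne : ∃ z ∈ Set.Ioo (0 : ℝ) 1, IsSuper lam μ₁ μ₂ m (z, 0)) :
    ∃ z ∈ Set.Ioo (0 : ℝ) 1, IsSuper lam μ₁ μ₂ m (z, 0) ∧ Phat lam μ₁ μ₂ z (m + 1) 0 = 0 ∧
      ∀ y ∈ Set.Ioo (0 : ℝ) 1, IsSuper lam μ₁ μ₂ m (y, 0) → z ≤ y := by
  obtain ⟨Z, hZI, hZ⟩ := hne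
  set a := lam * μ₁ / ((μ₁ + μ₂) * (lam + μ₁ + μ₂)) with ha
  have ha0 : 0 < a := by positivity
  have hlow : ∀ y ∈ Set.Ioo (0 : ℝ) 1, IsSuper lam μ₁ μ₂ m (y, 0) → a ≤ y := fun y hy h =>
    h.lower_bound hlam hμ₁ hμ₂ hm hy.1
  have hcl : IsClosed {z : ℝ | (∀ n ≤ m, 0 ≤ P lam μ₁ μ₂ z n 0) ∧
      0 ≤ Phat lam μ₁ μ₂ z (m + 1) 0} :=
    (isClosed_setOf_nonneg lam μ₁ μ₂ m).preimage (f := fun z : ℝ => ((z, 0) : ℝ × ℝ))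
      (by fun_prop)
  obtain ⟨z, ⟨hzI, hz⟩, hmin⟩ := (isCompact_Icc.inter_right hcl).exists_isLeast
    ⟨Z, (⟨hlow Z hZI hZ, le_rfl⟩ : Z ∈ Set.Icc a Z), ⟨fun n hn => (hZ.1 n hn).le, hZ.2⟩⟩
  have hz0 : 0 < z := ha0.trans_le hzI.1
  have hz1 : z < 1 := hzI.2.trans_lt hZI.2
  have hs : IsSuper lam μ₁ μ₂ m (z, 0) := isSuper_of_nonneg hlam hμ₁ hz0 hz.1 hz.2
  have hleast : ∀ y ∈ Set.Ioo (0 : ℝ) 1, IsSuper lam μ₁ μ₂ m (y, 0) → z ≤ y := by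
    intro y hy hys
    by_contra! hlt
    have := hmin ⟨⟨hlow y hy hys, hlt.le.trans hzI.2⟩, fun n hn => (hys.1 n hn).le, hys.2⟩
    linarith
  refine ⟨z, ⟨hz0, hz1⟩, hs, ?_, hleast⟩
  by_contra hne0
  have hpos : 0 < Phat lam μ₁ μ₂ z (m + 1) 0 := lt_of_le_of_ne hs.2 (Ne.symm hne0)
  have h1 : ∀ᶠ y in 𝓝 z, IsSuper lam μ₁ μ₂ m (y, 0) :=
    (by fun_prop : Continuous fun y : ℝ => ((y, 0) : ℝ × ℝ)).continuousAt.eventually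
      (hs.eventually hpos)
  obtain ⟨y, hy, hy0, hyz⟩ := ((h1.filter_mono nhdsWithin_le_nhds).and
    (Ioo_mem_nhdsLT hz0)).exists
  linarith [hleast y ⟨hy0, hyz.trans hz1⟩ hy]

/-! ### Stability as the sign of a derivative at `z = 1` -/

theorem P_at_one (hμ₁ : 0 < μ₁) : ∀ n, P lam μ₁ μ₂ 1 n 0 = (lam / μ₁) ^ n
  | 0 => by rw [P_zero, pow_zero]
  | 1 => by rw [P_one]; field_simp; ring
  | n + 2 => by
    rw [P_add_two, P_at_one hμ₁ (n + 1), P_at_one hμ₁ n]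
    obtain ⟨r, rfl⟩ : ∃ r, lam = r * μ₁ := ⟨lam / μ₁, by field_simp⟩
    simp only [mul_div_cancel_right₀ _ hμ₁.ne', pow_succ]
    generalize r ^ n = t
    field_simp
    ring

/-- The derivatives at `z = 1` of `P n` and of `P (n + 1) - ρ₁ z P n`. -/
theorem exists_hasDerivAt_P (hμ₁ : 0 < μ₁) (n : ℕ) :
    ∃ d d' : ℝ, HasDerivAt (fun z => P lam μ₁ μ₂ z n 0) d 1 ∧
      HasDerivAt (fun z => P lam μ₁ μ₂ z (n + 1) 0) d' 1 ∧
      d' - lam / μ₁ * d - (lam / μ₁) ^ (n + 1)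
        = -(μ₂ / μ₁) * ∑ k ∈ Finset.range (n + 1), (lam / μ₁) ^ k
          + lam / μ₁ * ∑ k ∈ Finset.range n, (lam / μ₁) ^ k := by
  have hlin : ∀ c : ℝ, HasDerivAt (fun z : ℝ => c + μ₂ * (1 - z)) (-μ₂) 1 := fun c => by
    simpa using (((hasDerivAt_id (1 : ℝ)).const_sub 1).const_mul μ₂).const_add c
  have hzd : HasDerivAt (fun z : ℝ => z / μ₁) (1 / μ₁) 1 := (hasDerivAt_id (1 : ℝ)).div_const μ₁
  induction n with
  | zero =>
    refine ⟨0, 1 / μ₁ * (0 + lam + μ₂ * (1 - 1)) + 1 / μ₁ * (-μ₂), ?_, ?_, ?_⟩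
    · simp only [P_zero]; exact hasDerivAt_const _ _
    · simp only [zero_add, P_one]
      have := hzd.mul (hlin lam)
      refine this.congr_deriv ?_
      ring
    · simp; ring
  | succ n ih =>
    obtain ⟨d, d', hd, hd', heq⟩ := ih
    refine ⟨d', _, hd', (hzd.mul (((hlin (0 + lam + μ₁)).mul hd').sub (hd.const_mul lam))), ?_⟩
    simp only [P_at_one hμ₁]
    rw [Finset.sum_range_succ _ (n + 1), Finset.sum_range_succ _ n] at *
    have hd'eq : d' = lam / μ₁ * d + (lam / μ₁) ^ (n + 1)
        + (-(μ₂ / μ₁) * (∑ k ∈ Finset.range n, (lam / μ₁) ^ k + (lam / μ₁) ^ n)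
          + lam / μ₁ * ∑ k ∈ Finset.range n, (lam / μ₁) ^ k) := by linarith
    rw [hd'eq]
    generalize ∑ k ∈ Finset.range n, (lam / μ₁) ^ k = S
    obtain ⟨r, rfl⟩ : ∃ r, lam = r * μ₁ := ⟨lam / μ₁, by field_simp⟩
    simp only [mul_div_cancel_right₀ _ hμ₁.ne', pow_succ]
    generalize r ^ n = t
    field_simp
    ring

/-- Geometric sums clear the denominators and unite the two cases of the stability condition; the
difference of the two sides, divided by `μ₁`, is the derivative of `Phat` at `z = 1`. -/
theorem Stable.sum_lt (hlam : 0 < lam) (hμ₁ : 0 < μ₁) (hμ₂ : 0 < μ₂) {m : ℕ} (hm : 1 ≤ m)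
    (h : Stable lam μ₁ μ₂ m) :
    lam * ∑ k ∈ Finset.range m, (lam / μ₁) ^ k
      < μ₂ * ∑ k ∈ Finset.range (m + 1), (lam / μ₁) ^ k := by
  have hm0 : (0 : ℝ) < m := by exact_mod_cast hm
  have hρ : 0 < lam / μ₁ := div_pos hlam hμ₁
  by_cases h1 : lam / μ₁ = 1
  · have := h.2 h1
    rw [h1]
    simp only [one_pow, Finset.sum_const, Finset.card_range, nsmul_eq_mul, mul_one]
    push_cast
    rw [div_lt_iff₀ hμ₂] at this
    have h3 := mul_lt_mul_of_pos_right this hm0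
    have : (1 + 1 / (m : ℝ)) * μ₂ * m = μ₂ * (m + 1) := by field_simp
    linarith
  · have hlt := h.1 h1
    have hS : 0 < ∑ k ∈ Finset.range m, (lam / μ₁) ^ k :=
      Finset.sum_pos (fun k _ => pow_pos hρ k) ⟨0, by simp; omega⟩
    have e1 : 1 - (lam / μ₁) ^ (m + 1)
        = (1 - lam / μ₁) * ∑ k ∈ Finset.range (m + 1), (lam / μ₁) ^ k :=
      (mul_neg_geom_sum _ _).symm
    have e2 : 1 - (lam / μ₁) ^ m = (1 - lam / μ₁) * ∑ k ∈ Finset.range m, (lam / μ₁) ^ k :=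
      (mul_neg_geom_sum _ _).symm
    rw [e1, e2, mul_div_mul_left _ _ (sub_ne_zero.2 (Ne.symm h1)), div_lt_div_iff₀ hμ₂ hS] at hlt
    linarith

/-- `Phat` vanishes at `z = 1` with negative derivative, so it is positive just to the left, where
the `P n`, equal to `ρ₁ ^ n > 0` at `1`, are still positive. -/
theorem Stable.exists_isSuper (hlam : 0 < lam) (hμ₁ : 0 < μ₁) (hμ₂ : 0 < μ₂) {m : ℕ} (hm : 1 ≤ m)
    (h : Stable lam μ₁ μ₂ m) : ∃ z ∈ Set.Ioo (0 : ℝ) 1, IsSuper lam μ₁ μ₂ m (z, 0) := by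
  obtain ⟨d, d', hd, hd', heq⟩ := exists_hasDerivAt_P (lam := lam) (μ₂ := μ₂) hμ₁ m
  have hsum := h.sum_lt hlam hμ₁ hμ₂ hm
  have hzd : HasDerivAt (fun z : ℝ => lam * z / μ₁) (lam / μ₁) 1 := by
    simpa using ((hasDerivAt_id (1 : ℝ)).const_mul lam).div_const μ₁
  have hhat : HasDerivAt (fun z => Phat lam μ₁ μ₂ z (m + 1) 0)
      (d' - lam / μ₁ * d - (lam / μ₁) ^ (m + 1)) 1 := by
    have := hd'.sub (hzd.mul hd)
    simp only [Phat_succ]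
    refine this.congr_deriv ?_
    rw [P_at_one hμ₁, pow_succ]
    ring
  have hneg : d' - lam / μ₁ * d - (lam / μ₁) ^ (m + 1) < 0 := by
    rw [heq]
    have := div_lt_div_of_pos_right hsum hμ₁
    rw [mul_div_right_comm, mul_div_right_comm] at this
    linarith
  have h0 : Phat lam μ₁ μ₂ 1 (m + 1) 0 = 0 := by
    rw [Phat_succ, P_at_one hμ₁, P_at_one hμ₁, pow_succ]; ring
  have hslope := (hasDerivAt_iff_tendsto_slope.1 hhat).eventually_lt_const hneg
  have hle : 𝓝[<] (1 : ℝ) ≤ 𝓝[≠] 1 := nhdsWithin_mono _ fun z hz => ne_of_lt hz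
  have hpos : ∀ᶠ z in 𝓝[<] (1 : ℝ), ∀ n ∈ Set.Iic m, 0 < P lam μ₁ μ₂ z n 0 := by
    refine (Filter.eventually_all_finite (Set.finite_Iic m)).2 fun n _ => ?_
    have hc : Continuous fun z : ℝ => P lam μ₁ μ₂ z n 0 :=
      (continuous_P lam μ₁ μ₂ n).comp (by fun_prop : Continuous fun z : ℝ => ((z, 0) : ℝ × ℝ))
    exact (hc.continuousAt.eventually_const_lt
      (by simp only [P_at_one hμ₁]; exact pow_pos (div_pos hlam hμ₁) n)).filter_mono nhdsWithin_le_nhds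
  obtain ⟨z, ⟨hz1, hz2⟩, hz3⟩ := ((hslope.filter_mono hle).and hpos |>.and
    (Ioo_mem_nhdsLT (zero_lt_one' ℝ))).exists
  refine ⟨z, hz3, hz2, ?_⟩
  rw [slope_def_field, h0, sub_zero, div_neg_iff] at hz1
  rcases hz1 with hz1 | hz1
  · exact hz1.1.le
  · linarith [hz1.2, hz3.2]

end Polynomials

/-! ### The tandem blocks and their eigenvectors -/

section Blocks

variable {lam μ₁ μ₂ : ℝ}

theorem sum_ite_val_eq {m : ℕ} (a : ℕ) (c : ℝ) (v : ℕ → ℝ) :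
    ∑ j : Fin (m + 1), (if (j : ℕ) = a then c else 0) * v j = if a ≤ m then c * v a else 0 := by
  rw [Fin.sum_univ_eq_sum_range (fun j => (if j = a then c else 0) * v j) (m + 1)]
  simp [ite_mul, Finset.sum_ite_eq']

theorem Q0_mulVec (μ₁ : ℝ) {m : ℕ} (v : ℕ → ℝ) (i : Fin (m + 1)) :
    (Q0 μ₁ m).mulVec (fun j => v j) i = if 0 < (i : ℕ) then μ₁ * v (i - 1) else 0 := by
  obtain ⟨i, hi⟩ := i
  simp only [Matrix.mulVec, dotProduct, Q0, Matrix.of_apply]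
  rcases i with _ | i
  · simp
  · have := sum_ite_val_eq (m := m) i μ₁ v
    simp only [if_pos (show i ≤ m by omega)] at this
    simpa [eq_comm] using this

theorem Q0_transpose_mulVec (μ₁ : ℝ) {m : ℕ} (v : ℕ → ℝ) (i : Fin (m + 1)) :
    (Q0 μ₁ m).transpose.mulVec (fun j => v j) i = if (i : ℕ) < m then μ₁ * v (i + 1) else 0 := by
  simp only [Matrix.mulVec, dotProduct, Q0, Matrix.of_apply, Matrix.transpose_apply]
  rw [sum_ite_val_eq ((i : ℕ) + 1) μ₁ v]
  rfl

/-- The negative of the diagonal of `Q₁`. -/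
noncomputable def exitRate (lam μ₁ μ₂ : ℝ) (m i : ℕ) : ℝ :=
  (if i < m then lam else 0) + (if 0 < i then μ₁ else 0) + μ₂

theorem exitRate_pos (hlam : 0 < lam) (hμ₁ : 0 < μ₁) (hμ₂ : 0 < μ₂) (m i : ℕ) :
    0 < exitRate lam μ₁ μ₂ m i := by
  unfold exitRate
  split_ifs <;> linarith

theorem Q1_apply (lam μ₁ μ₂ : ℝ) {m : ℕ} (i j : Fin (m + 1)) :
    Q1 lam μ₁ μ₂ m i j = (if (j : ℕ) = i + 1 then lam else 0)
      + (if (j : ℕ) = i then -exitRate lam μ₁ μ₂ m i else 0) := by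
  simp only [Q1, Matrix.of_apply, exitRate, Fin.ext_iff]
  by_cases h1 : (j : ℕ) = i + 1
  · rw [if_pos h1, if_pos h1, if_neg (by omega), add_zero]
  · by_cases h2 : (i : ℕ) = j
    · rw [if_neg h1, if_pos h2, if_neg h1, if_pos h2.symm, zero_add]
    · rw [if_neg h1, if_neg h2, if_neg h1, if_neg (Ne.symm h2), zero_add]

theorem Q1_mulVec (lam μ₁ μ₂ : ℝ) {m : ℕ} (v : ℕ → ℝ) (i : Fin (m + 1)) :
    (Q1 lam μ₁ μ₂ m).mulVec (fun j => v j) i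
      = (if (i : ℕ) < m then lam * v (i + 1) else 0) - exitRate lam μ₁ μ₂ m i * v i := by
  simp only [Matrix.mulVec, dotProduct, Q1_apply, add_mul, Finset.sum_add_distrib]
  rw [sum_ite_val_eq ((i : ℕ) + 1) lam v, sum_ite_val_eq (i : ℕ) (-exitRate lam μ₁ μ₂ m i) v,
    if_pos (Nat.lt_succ_iff.1 i.2), neg_mul, ← sub_eq_add_neg]
  rfl

theorem Q1_transpose_mulVec (lam μ₁ μ₂ : ℝ) {m : ℕ} (v : ℕ → ℝ) (i : Fin (m + 1)) :
    (Q1 lam μ₁ μ₂ m).transpose.mulVec (fun j => v j) i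
      = (if 0 < (i : ℕ) then lam * v (i - 1) else 0) - exitRate lam μ₁ μ₂ m i * v i := by
  simp only [Matrix.mulVec, dotProduct, Matrix.transpose_apply, Q1_apply, add_mul,
    Finset.sum_add_distrib]
  have h1 : ∑ j : Fin (m + 1), (if (i : ℕ) = j then -exitRate lam μ₁ μ₂ m j else 0) * v j
      = -(exitRate lam μ₁ μ₂ m i * v i) := by
    simp [← Fin.ext_iff, ite_mul]
  rw [h1, ← sub_eq_add_neg]
  congr 1
  obtain ⟨i, hi⟩ := i
  rcases i with _ | i
  · simp
  · have := sum_ite_val_eq (m := m) i lam v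
    simp only [if_pos (show i ≤ m by omega)] at this
    simpa [eq_comm] using this

theorem Q2_transpose (μ₂ : ℝ) (m : ℕ) : (Q2 μ₂ m).transpose = Q2 μ₂ m := by
  ext i j
  simp only [Q2, Matrix.transpose_apply, Matrix.of_apply, eq_comm]

theorem Q2_mulVec (μ₂ : ℝ) {m : ℕ} (v : Fin (m + 1) → ℝ) (i : Fin (m + 1)) :
    (Q2 μ₂ m).mulVec v i = μ₂ * v i := by
  simp [Matrix.mulVec, dotProduct, Q2]

theorem isRateBlocks_tandem (hlam : 0 < lam) (hμ₁ : 0 < μ₁) (hμ₂ : 0 < μ₂) (m : ℕ) :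
    IsRateBlocks (Q0 μ₁ m) (Q1 lam μ₁ μ₂ m) (Q2 μ₂ m) (fun _ => 1) where
  up_nonneg i j := by simp only [Q0, Matrix.of_apply]; split_ifs <;> linarith
  within_nonneg i j hij := by
    rw [Q1_apply, if_neg (fun h => hij (Fin.ext h)), add_zero]
    split_ifs <;> linarith
  down_nonneg i j := by simp only [Q2, Matrix.of_apply]; split_ifs <;> linarith
  diag_neg i := by
    have := exitRate_pos hlam hμ₁ hμ₂ m i
    simp [Q1_apply]
    linarith
  down_diag_pos i := by simpa [Q2] using hμ₂
  pos _ := one_pos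
  harmonic i := by
    have h0 := Q0_mulVec μ₁ (m := m) (fun _ => 1) i
    have h1 := Q1_mulVec lam μ₁ μ₂ (m := m) (fun _ => 1) i
    have h2 := Q2_mulVec μ₂ (fun _ => 1) i
    simp only [Matrix.mulVec, dotProduct] at h0 h1 h2
    rw [Finset.sum_add_distrib, Finset.sum_add_distrib, h0, h1, h2, exitRate]
    split_ifs <;> ring

/-- The time-reversed network. -/
theorem isRateBlocks_tandem_transpose (hlam : 0 < lam) (hμ₁ : 0 < μ₁) (hμ₂ : 0 < μ₂) (m : ℕ) :
    IsRateBlocks (Q0 μ₁ m).transpose (Q1 lam μ₁ μ₂ m).transpose (Q2 μ₂ m).transpose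
      (fun i => (lam / μ₁) ^ (i : ℕ)) where
  up_nonneg i j := (isRateBlocks_tandem hlam hμ₁ hμ₂ m).up_nonneg j i
  within_nonneg i j hij := (isRateBlocks_tandem hlam hμ₁ hμ₂ m).within_nonneg j i hij.symm
  down_nonneg i j := (isRateBlocks_tandem hlam hμ₁ hμ₂ m).down_nonneg j i
  diag_neg i := (isRateBlocks_tandem hlam hμ₁ hμ₂ m).diag_neg i
  down_diag_pos i := (isRateBlocks_tandem hlam hμ₁ hμ₂ m).down_diag_pos i
  pos _ := pow_pos (div_pos hlam hμ₁) _
  harmonic i := by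
    have h0 := Q0_transpose_mulVec μ₁ (m := m) (fun i => (lam / μ₁) ^ i) i
    have h1 := Q1_transpose_mulVec lam μ₁ μ₂ (m := m) (fun i => (lam / μ₁) ^ i) i
    have h2 := Q2_mulVec μ₂ (m := m) (fun i => (lam / μ₁) ^ (i : ℕ)) i
    simp only [Matrix.mulVec, dotProduct] at h0 h1 h2
    rw [Q2_transpose, Finset.sum_add_distrib, Finset.sum_add_distrib, h0, h1, h2, exitRate]
    generalize (i : ℕ) = i
    rcases i with _ | i
    · have hr : μ₁ * (lam / μ₁) = lam := mul_div_cancel₀ _ hμ₁.ne'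
      simp only [lt_irrefl, if_false, zero_add, pow_one, pow_zero, hr]
      split_ifs <;> ring
    · simp only [Nat.succ_pos, if_true, Nat.add_sub_cancel, pow_succ]
      generalize (lam / μ₁) ^ i = t
      split_ifs <;> field_simp <;> ring

theorem tandem_mulVec_phaseVec (hlam : 0 < lam) (hμ₁ : 0 < μ₁) {m : ℕ} {z : ℝ} (hz0 : 0 < z)
    (h : Phat lam μ₁ μ₂ z (m + 1) 0 = 0) :
    (Q0 μ₁ m).mulVec (fun j => phaseVec lam μ₁ μ₂ z 0 j)
      + z • (Q1 lam μ₁ μ₂ m).mulVec (fun j => phaseVec lam μ₁ μ₂ z 0 j)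
      + z ^ 2 • (Q2 μ₂ m).mulVec (fun j => phaseVec lam μ₁ μ₂ z 0 j) = 0 := by
  ext i
  simp only [Pi.add_apply, Pi.smul_apply, smul_eq_mul, Pi.zero_apply]
  have hop := phaseOp_phaseVec hlam hμ₁ hz0 h (Nat.lt_succ_iff.1 i.2)
  rw [Q0_mulVec, Q1_mulVec, Q2_mulVec, exitRate]
  rw [zero_mul, phaseOp] at hop
  refine Eq.trans ?_ ((congrArg (z * ·) hop).trans (mul_zero z))
  generalize phaseVec lam μ₁ μ₂ z 0 = v
  split_ifs <;> field_simp <;> ring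

theorem tandem_transpose_mulVec_P (hμ₁ : 0 < μ₁) {m : ℕ} {z : ℝ}
    (h : Phat lam μ₁ μ₂ z (m + 1) 0 = 0) :
    (Q0 μ₁ m).transpose.mulVec (fun j => P lam μ₁ μ₂ z j 0)
      + z • (Q1 lam μ₁ μ₂ m).transpose.mulVec (fun j => P lam μ₁ μ₂ z j 0)
      + z ^ 2 • (Q2 μ₂ m).transpose.mulVec (fun j => P lam μ₁ μ₂ z j 0) = 0 := by
  ext ⟨i, hi⟩
  simp only [Pi.add_apply, Pi.smul_apply, smul_eq_mul, Pi.zero_apply]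
  rw [Q0_transpose_mulVec μ₁ (fun j => P lam μ₁ μ₂ z j 0),
    Q1_transpose_mulVec lam μ₁ μ₂ (fun j => P lam μ₁ μ₂ z j 0), Q2_transpose, Q2_mulVec, exitRate]
  simp only
  rw [Phat_succ, sub_eq_zero] at h
  -- At phase `m` the relation `μ₁ P (m + 1) = lam * z * P m` makes up for both the missing up term
  -- and the missing arrival rate in the diagonal.
  have h1 : (if i < m then μ₁ * P lam μ₁ μ₂ z (i + 1) 0 else 0)
      = μ₁ * P lam μ₁ μ₂ z (i + 1) 0 - (if i < m then 0 else lam * z * P lam μ₁ μ₂ z i 0) := by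
    split_ifs with hlt
    · ring
    · obtain rfl : i = m := by omega
      rw [h]
      field_simp
      ring
  rw [h1]
  rcases i with _ | i
  · simp only [lt_irrefl, if_false, zero_add, P_one, P_zero]
    split_ifs <;> field_simp <;> ring
  · simp only [Nat.succ_pos, if_true, Nat.add_sub_cancel, P_add_two]
    split_ifs <;> field_simp <;> ring

theorem isMaximalEigenvalue_tandemH (hlam : 0 < lam) (hμ₁ : 0 < μ₁) (hμ₂ : 0 < μ₂) {m : ℕ} {z : ℝ}
    (hz : z ∈ Set.Ioo (0 : ℝ) 1) (h : IsSuper lam μ₁ μ₂ m (z, 0))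
    (h0 : Phat lam μ₁ μ₂ z (m + 1) 0 = 0) :
    IsMaximalEigenvalue (tandemH lam μ₁ μ₂ m) z := by
  have hQ := isRateBlocks_tandem hlam hμ₁ hμ₂ m
  have hpos : ∀ i : Fin (m + 1), 0 < phaseVec lam μ₁ μ₂ z 0 i := fun i =>
    h.phaseVec_pos hlam hμ₁ hz.1 i (Nat.lt_succ_iff.1 i.2)
  exact isMaximalEigenvalue_of_pos hQ.hitMatrix_nonneg hpos (Nat.succ_pos m)
    (hQ.hitMatrix_mulVec hz.1 hz.2 hpos (tandem_mulVec_phaseVec hlam hμ₁ hz.1 h0))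

theorem exists_isMinimalR_tandem (hlam : 0 < lam) (hμ₁ : 0 < μ₁) (hμ₂ : 0 < μ₂) {m : ℕ} {z : ℝ}
    (hz : z ∈ Set.Ioo (0 : ℝ) 1) (h : IsSuper lam μ₁ μ₂ m (z, 0))
    (h0 : Phat lam μ₁ μ₂ z (m + 1) 0 = 0) :
    ∃ R, IsMinimalR (Q0 μ₁ m) (Q1 lam μ₁ μ₂ m) (Q2 μ₂ m) R ∧ IsMaximalEigenvalue R z := by
  have hQ := isRateBlocks_tandem_transpose hlam hμ₁ hμ₂ m
  have hpos : ∀ i : Fin (m + 1), 0 < P lam μ₁ μ₂ z i 0 := fun i =>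
    h.1 i (Nat.lt_succ_iff.1 i.2)
  exact ⟨_, hQ.isMinimalH_hitMatrix.transpose,
    (isMaximalEigenvalue_of_pos hQ.hitMatrix_nonneg hpos (Nat.succ_pos m)
      (hQ.hitMatrix_mulVec hz.1 hz.2 hpos (tandem_transpose_mulVec_P hμ₁ h0))).transpose⟩

end Blocks

/-! ### Monotonicity in the capacity, and the limit -/

section Limit

variable {lam μ₁ μ₂ : ℝ}

/-- `Phat (m + 2) ≥ 0` reads `lam * P m ≤ (μ₁ + μ₂ (1 - z)) * P (m + 1)`. The claim follows from `z
(μ₁ + μ₂ (1 - z)) < μ₁`, which is `(1 - z) (μ₁ - μ₂ z) > 0`. -/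
theorem IsSuper.of_succ (hμ₁ : 0 < μ₁) (hμ₂ : 0 < μ₂) {m : ℕ} {z : ℝ}
    (hz0 : 0 < z) (hz1 : z < 1) (hz : z < μ₁ / μ₂) (h : IsSuper lam μ₁ μ₂ (m + 1) (z, 0)) :
    IsSuper lam μ₁ μ₂ m (z, 0) ∧ 0 < Phat lam μ₁ μ₂ z (m + 1) 0 := by
  suffices hpos : 0 < Phat lam μ₁ μ₂ z (m + 1) 0 from
    ⟨⟨fun n hn => h.1 n (by omega), hpos.le⟩, hpos⟩
  have ha := h.1 m (by omega)
  have hb := h.1 (m + 1) le_rfl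
  have h1 := h.2
  simp only [Phat_succ, P_add_two] at h1 ha hb ⊢
  set a := P lam μ₁ μ₂ z m 0
  set b := P lam μ₁ μ₂ z (m + 1) 0
  have hc : 0 < μ₂ * (1 - z) := mul_pos hμ₂ (by linarith)
  have hab : 0 ≤ (μ₁ + μ₂ * (1 - z)) * b - lam * a := by
    refine nonneg_of_mul_nonneg_right (a := z / μ₁) ?_ (div_pos hz0 hμ₁)
    calc (0 : ℝ) ≤ _ := h1
      _ = _ := by ring
  have hlt : z * (μ₁ + μ₂ * (1 - z)) < μ₁ := by
    rw [lt_div_iff₀ hμ₂] at hz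
    nlinarith
  rw [sub_pos, mul_comm, ← mul_div_assoc, div_lt_iff₀ hμ₁]
  have e1 := mul_le_mul_of_nonneg_left (sub_nonneg.1 hab) hz0.le
  have e2 := mul_lt_mul_of_pos_right hlt hb
  linarith

theorem P_at_rho₂ (hlam : 0 < lam) (hμ₁ : 0 < μ₁) (hμ₂ : 0 < μ₂) :
    ∀ n, P lam μ₁ μ₂ (lam / μ₂) n 0 = (lam / μ₁) ^ n
  | 0 => by rw [P_zero, pow_zero]
  | 1 => by rw [P_one]; field_simp; ring
  | n + 2 => by
    rw [P_add_two, P_at_rho₂ hlam hμ₁ hμ₂ (n + 1), P_at_rho₂ hlam hμ₁ hμ₂ n]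
    simp only [pow_succ]
    generalize (lam / μ₁) ^ n = t
    field_simp
    ring

theorem isSuper_rho₂ (hlam : 0 < lam) (hμ₁ : 0 < μ₁) (hμ₂ : 0 < μ₂) (h : lam < μ₂) (m : ℕ) :
    IsSuper lam μ₁ μ₂ m (lam / μ₂, 0) ∧ 0 < Phat lam μ₁ μ₂ (lam / μ₂) (m + 1) 0 := by
  suffices hpos : 0 < Phat lam μ₁ μ₂ (lam / μ₂) (m + 1) 0 from
    ⟨⟨fun n _ => by
      simp only [P_at_rho₂ hlam hμ₁ hμ₂]; exact pow_pos (div_pos hlam hμ₁) n, hpos.le⟩, hpos⟩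
  rw [Phat_succ, P_at_rho₂ hlam hμ₁ hμ₂, P_at_rho₂ hlam hμ₁ hμ₂, pow_succ]
  have h1 : lam / μ₂ < 1 := (div_lt_one hμ₂).2 h
  have h2 : 0 < (lam / μ₁) ^ m * (lam / μ₁) * (1 - lam / μ₂) :=
    mul_pos (mul_pos (pow_pos (div_pos hlam hμ₁) m) (div_pos hlam hμ₁)) (by linarith)
  calc 0 < _ := h2
    _ = _ := by ring

/-! ### Positivity of all `P n` and the function `τ` -/

/-- The ratios `P (n + 1) / P n` decrease to a negative value, if each step from a value at most
the initial one is bounded away from `0`. -/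
theorem exists_P_nonpos {z d : ℝ} (hz0 : 0 < z) (hμ₁ : 0 < μ₁) (hd : 0 < d)
    (hstep : ∀ q, 0 < q → q ≤ P lam μ₁ μ₂ z 1 0 →
      d ≤ lam / q + μ₁ / z * q - (lam + μ₁ + μ₂ * (1 - z))) :
    ∃ n, P lam μ₁ μ₂ z n 0 ≤ 0 := by
  by_contra! hpos
  have hzm : 0 < z / μ₁ := div_pos hz0 hμ₁
  set q : ℕ → ℝ := fun n => P lam μ₁ μ₂ z (n + 1) 0 / P lam μ₁ μ₂ z n 0 with hq
  have hqpos : ∀ n, 0 < q n := fun n => div_pos (hpos _) (hpos _)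
  have hrec : ∀ n, q (n + 1) = q n - z / μ₁ *
      (lam / q n + μ₁ / z * q n - (lam + μ₁ + μ₂ * (1 - z))) := by
    intro n
    have h1 := (hpos n).ne'
    have h2 := (hpos (n + 1)).ne'
    simp only [hq]
    rw [P_add_two]
    field_simp
    ring
  have hbound : ∀ n : ℕ, q n ≤ q 0 - n * (z / μ₁ * d) := by
    intro n
    induction n with
    | zero => simp
    | succ n ih =>
      have hle : q n ≤ P lam μ₁ μ₂ z 1 0 := by
        have h0 : q 0 = P lam μ₁ μ₂ z 1 0 := by simp [hq, P_zero]
        have : 0 ≤ n * (z / μ₁ * d) := by positivity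
        linarith
      have := mul_le_mul_of_nonneg_left (hstep (q n) (hqpos n) hle) hzm.le
      rw [hrec n]
      push_cast
      linarith
  obtain ⟨n, hn⟩ := exists_nat_gt (q 0 / (z / μ₁ * d))
  rw [div_lt_iff₀ (by positivity)] at hn
  linarith [hbound n, hqpos n]

theorem tau_le_zero_iff {z : ℝ} :
    tau lam μ₁ μ₂ z ≤ 0 ↔ 2 * √(lam * μ₁ / z) ≤ lam + μ₁ + μ₂ * (1 - z) := by
  rw [tau]
  constructor <;> intro h <;> linarith

/-- By the inequality of arithmetic and geometric means, `τ(z)` is a lower bound for the step in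
`exists_P_nonpos`, so `τ(z) > 0` would drive the ratios below `0`. -/
theorem tau_le_zero_of_pos (hlam : 0 < lam) (hμ₁ : 0 < μ₁) {z : ℝ} (hz0 : 0 < z)
    (h : ∀ n, 0 < P lam μ₁ μ₂ z n 0) : tau lam μ₁ μ₂ z ≤ 0 := by
  by_contra! hτ
  obtain ⟨n, hn⟩ := exists_P_nonpos hz0 hμ₁ hτ (μ₂ := μ₂) fun q hq _ => by
    have h1 : 2 * √(lam * μ₁ / z) ≤ lam / q + μ₁ / z * q := by
      have h2 : √(lam * μ₁ / z) ≤ (lam / q + μ₁ / z * q) / 2 := by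
        refine Real.sqrt_le_iff.2 ⟨by positivity, ?_⟩
        have h3 : ((lam / q + μ₁ / z * q) / 2) ^ 2 - lam * μ₁ / z
            = ((lam / q - μ₁ / z * q) / 2) ^ 2 := by field_simp; ring
        nlinarith [sq_nonneg ((lam / q - μ₁ / z * q) / 2)]
      linarith
    rw [tau]
    linarith
  exact absurd (h n) (not_lt.2 hn)

/-- `τ` at `s ^ 2`, multiplied with `s`. -/
theorem mul_tau_sq (hlam : 0 < lam) (hμ₁ : 0 < μ₁) {s : ℝ} (hs : 0 < s) :
    s * tau lam μ₁ μ₂ (s ^ 2)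
      = 2 * √(lam * μ₁) - s * (lam + μ₁ + μ₂ - μ₂ * s ^ 2) := by
  rw [tau, Real.sqrt_div (mul_pos hlam hμ₁).le, Real.sqrt_sq hs.le]
  field_simp
  ring

theorem two_sqrt_lt (hlam : 0 < lam) (h : lam < μ₁) :
    2 * √(lam * μ₁) < lam + μ₁ := by
  have h1 : √(lam * μ₁) < (lam + μ₁) / 2 := by
    rw [Real.sqrt_lt' (by linarith)]
    nlinarith [sq_pos_of_pos (sub_pos.2 h)]
  linarith

/-- In `s = √z` the function `s τ(s²)` is strictly convex on `s > 0` and negative at `s = 1`, so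
once nonpositive it is negative up to `1`. -/
theorem tau_neg_of_lt (hlam : 0 < lam) (hμ₁ : 0 < μ₁) (hμ₂ : 0 < μ₂) (h : lam < μ₁) {y z : ℝ}
    (hy0 : 0 < y) (hyz : y < z) (hz1 : z < 1) (hy : tau lam μ₁ μ₂ y ≤ 0) :
    tau lam μ₁ μ₂ z < 0 := by
  obtain ⟨p, hp, rfl⟩ : ∃ p, 0 < p ∧ p ^ 2 = y := ⟨√y, Real.sqrt_pos.2 hy0, Real.sq_sqrt hy0.le⟩
  have hz0 := hy0.trans hyz
  obtain ⟨s, hs, rfl⟩ : ∃ s, 0 < s ∧ s ^ 2 = z := ⟨√z, Real.sqrt_pos.2 hz0, Real.sq_sqrt hz0.le⟩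
  have hps : p < s := lt_of_pow_lt_pow_left₀ 2 hs.le hyz
  have hs1 : s < 1 := by nlinarith
  have e1 := mul_tau_sq hlam hμ₁ hp (μ₂ := μ₂)
  have e2 := mul_tau_sq hlam hμ₁ hs (μ₂ := μ₂)
  have e3 := two_sqrt_lt hlam h
  have h1 : p * tau lam μ₁ μ₂ (p ^ 2) ≤ 0 := mul_nonpos_of_nonneg_of_nonpos hp.le hy
  generalize √(lam * μ₁) = κ at e1 e2 e3
  have h2 : s * tau lam μ₁ μ₂ (s ^ 2) < 0 := by
    rw [e1] at h1
    rw [e2]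
    -- Convexity made explicit: `f1` and `f2` are the chord contributions from `p` and from `1`, and
    -- `f3` is the exact excess coming from the cubic term.
    have f1 : 0 ≤ (1 - s) * (p * (lam + μ₁ + μ₂ - μ₂ * p ^ 2) - 2 * κ) :=
      mul_nonneg (by linarith) (by linarith)
    have f2 : 0 < (s - p) * (lam + μ₁ - 2 * κ) := mul_pos (by linarith) (by linarith)
    have f3 : 0 < μ₂ * (1 - s) * (s - p) * (1 - p) * (1 + s + p) := by
      have := sub_pos.2 hs1
      have := sub_pos.2 hps
      have := sub_pos.2 (hps.trans hs1)
      positivity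
    have f4 : 0 < (1 - p) * (s * (lam + μ₁ + μ₂ - μ₂ * s ^ 2) - 2 * κ) := by
      calc 0 < _ := add_pos (add_pos_of_nonneg_of_pos f1 f2) f3
        _ = _ := by ring
    have := pos_of_mul_pos_right f4 (by linarith)
    linarith
  exact (pos_iff_neg_of_mul_neg h2).1 hs

theorem exists_tau_eq_zero (hlam : 0 < lam) (hμ₁ : 0 < μ₁) (h : lam < μ₁) :
    ∃ η ∈ Set.Ioo (0 : ℝ) 1, tau lam μ₁ μ₂ η = 0 := by
  have hcont : Continuous fun s : ℝ => s * (lam + μ₁ + μ₂ - μ₂ * s ^ 2) := by fun_prop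
  have hκ : 0 < √(lam * μ₁) := Real.sqrt_pos.2 (mul_pos hlam hμ₁)
  have hlt := two_sqrt_lt hlam h
  obtain ⟨s, hs, hseq⟩ := intermediate_value_Ioo (zero_le_one' ℝ) hcont.continuousOn
    (show 2 * √(lam * μ₁) ∈ Set.Ioo _ _ from ⟨by simpa using hκ, by simpa using hlt⟩)
  refine ⟨s ^ 2, ⟨pow_pos hs.1 2, pow_lt_one₀ hs.1.le hs.2 two_ne_zero⟩, ?_⟩
  have e := mul_tau_sq hlam hμ₁ hs.1 (μ₂ := μ₂)
  simp only at hseq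
  rw [hseq, sub_self] at e
  exact (mul_eq_zero.1 e).resolve_left hs.1.ne'

theorem tau_rho₂_nonpos (hlam : 0 < lam) (hμ₁ : 0 < μ₁) (hμ₂ : 0 < μ₂) :
    tau lam μ₁ μ₂ (lam / μ₂) ≤ 0 := by
  have h1 : lam * μ₁ / (lam / μ₂) = μ₁ * μ₂ := by field_simp
  have h2 : √(μ₁ * μ₂) ≤ (μ₁ + μ₂) / 2 := by
    refine Real.sqrt_le_iff.2 ⟨by positivity, ?_⟩
    nlinarith [sq_nonneg (μ₁ - μ₂)]
  have h3 : μ₂ * (1 - lam / μ₂) = μ₂ - lam := by field_simp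
  rw [tau, h1, h3]
  linarith

/-- In the critical case the ratios stay above the double fixed point of their recursion. -/
theorem isSuper_of_tau_eq_zero (hlam : 0 < lam) (hμ₁ : 0 < μ₁) {η : ℝ}
    (hη0 : 0 < η) (hη : tau lam μ₁ μ₂ η = 0) (hle : η ≤ lam / μ₁) (hlt : lam < μ₁) (m : ℕ) :
    IsSuper lam μ₁ μ₂ m (η, 0) := by
  set b := √(lam * μ₁ / η) with hb
  have hbpos : 0 < b := Real.sqrt_pos.2 (by positivity)
  have hb2 : b ^ 2 = lam * μ₁ / η := Real.sq_sqrt (by positivity)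
  have hB : lam + μ₁ + μ₂ * (1 - η) = 2 * b := by rw [tau] at hη; linarith
  -- The double fixed point is `lam / b`. As `lam + μ₁ + μ₂ (1 - η) = 2 b`, this bound, equivalent
  -- to `η ≤ ρ₁`, puts the initial ratio above it; `hηb` puts `lam / b` above the ratio `lam * η /
  -- μ₁` needed for `Phat ≥ 0`.
  have hμb : μ₁ ≤ b := by
    refine Real.le_sqrt_of_sq_le ?_
    rw [le_div_iff₀ hη0]
    rw [le_div_iff₀ hμ₁] at hle
    nlinarith
  have hηb : b * η ≤ μ₁ := by
    have h1 : η ≤ 1 := hle.trans ((div_le_one hμ₁).2 hlt.le)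
    have h2 : b ^ 2 * η = lam * μ₁ := by rw [hb2]; field_simp
    refine (sq_le_sq₀ (mul_pos hbpos hη0).le hμ₁.le).1 ?_
    calc (b * η) ^ 2 = (b ^ 2 * η) * η := by ring
      _ = lam * μ₁ * η := by rw [h2]
      _ ≤ lam * μ₁ * 1 := mul_le_mul_of_nonneg_left h1 (mul_pos hlam hμ₁).le
      _ ≤ μ₁ ^ 2 := by nlinarith
  have hηm : η / μ₁ = lam / b ^ 2 := by rw [hb2]; field_simp
  have key : ∀ n, 0 < P lam μ₁ μ₂ η n 0 ∧
      lam / b * P lam μ₁ μ₂ η n 0 ≤ P lam μ₁ μ₂ η (n + 1) 0 := by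
    intro n
    induction n with
    | zero =>
      rw [P_zero, P_one, hηm]
      refine ⟨one_pos, ?_⟩
      have h1 : b ≤ 0 + lam + μ₂ * (1 - η) := by linarith
      calc lam / b * 1 = lam / b ^ 2 * b := by field_simp
        _ ≤ _ := mul_le_mul_of_nonneg_left h1 (by positivity)
    | succ n ih =>
      obtain ⟨h1, h2⟩ := ih
      refine ⟨(mul_pos (div_pos hlam hbpos) h1).trans_le h2, ?_⟩
      rw [P_add_two, zero_add, hB, hηm]
      have h3 : lam * P lam μ₁ μ₂ η n 0 ≤ b * P lam μ₁ μ₂ η (n + 1) 0 := by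
        have := mul_le_mul_of_nonneg_left h2 hbpos.le
        calc _ = b * (lam / b * P lam μ₁ μ₂ η n 0) := by field_simp
          _ ≤ _ := this
      calc lam / b * P lam μ₁ μ₂ η (n + 1) 0
          = lam / b ^ 2 * (b * P lam μ₁ μ₂ η (n + 1) 0) := by field_simp
        _ ≤ _ := mul_le_mul_of_nonneg_left (by linarith) (by positivity)
  refine ⟨fun n _ => (key n).1, ?_⟩
  simp only [Phat_succ, sub_nonneg]
  refine le_trans (mul_le_mul_of_nonneg_right ?_ (key m).1.le) (key m).2
  rw [div_le_div_iff₀ hμ₁ hbpos]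
  have := mul_le_mul_of_nonneg_left hηb hlam.le
  linarith

/-- If the first server is the faster one, then no `z < ρ₂` admits a positive sequence. -/
theorem rho₂_le_of_pos (hlam : 0 < lam) (hμ₁ : 0 < μ₁) (hμ₂ : 0 < μ₂) (hlt : lam < μ₁)
    (h21 : μ₂ < μ₁) {z : ℝ} (hz0 : 0 < z) (hz1 : z < 1) (hpos : ∀ n, 0 < P lam μ₁ μ₂ z n 0) :
    lam / μ₂ ≤ z := by
  by_contra! hzρ
  rw [lt_div_iff₀ hμ₂] at hzρ
  have hτ := tau_le_zero_of_pos hlam hμ₁ hz0 hpos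
  set c := μ₂ * (1 - z) with hc
  have hc0 : 0 < c := mul_pos hμ₂ (by linarith)
  have hdisc : 4 * (lam * μ₁) ≤ (lam + μ₁ + c) ^ 2 * z := by
    have h1 := tau_le_zero_iff.1 hτ
    have h2 : √(lam * μ₁ / z) ^ 2 = lam * μ₁ / z := Real.sq_sqrt (by positivity)
    have h3 : (2 * √(lam * μ₁ / z)) ^ 2 ≤ (lam + μ₁ + c) ^ 2 :=
      pow_le_pow_left₀ (by positivity) h1 2
    rw [mul_pow, h2] at h3
    have h4 := mul_le_mul_of_nonneg_right h3 hz0.le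
    calc _ = 2 ^ 2 * (lam * μ₁ / z) * z := by field_simp; norm_num
      _ ≤ _ := h4
  -- Real fixed points together with `μ₂ < μ₁` place the initial ratio on the branch where the step
  -- is decreasing: with excess `t > 0`, the discriminant bound becomes a cubic inequality in `t`,
  -- refuted by `f1` to `f4`.
  have hcμ : lam + c ≤ μ₁ := by
    by_contra! hgt
    obtain ⟨t, ht⟩ : ∃ t, t = lam + c - μ₁ := ⟨_, rfl⟩
    have ht0 : 0 < t := by linarith
    have hμz : μ₂ * z = lam - (μ₁ - μ₂) - t := by rw [ht, hc]; ring
    have hd2 : 4 * (lam * μ₁) * μ₂ ≤ (2 * μ₁ + t) ^ 2 * (lam - (μ₁ - μ₂) - t) := by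
      have := mul_le_mul_of_nonneg_right hdisc hμ₂.le
      rw [← hμz]
      have e : lam + μ₁ + c = 2 * μ₁ + t := by rw [ht]; ring
      rw [e] at this
      linarith
    have e0 : lam - (μ₁ - μ₂) < μ₁ := by linarith
    have f1 : 0 < t * (4 * μ₁) * (μ₁ - (lam - (μ₁ - μ₂))) :=
      mul_pos (by positivity) (by linarith)
    have f2 : 0 < t ^ 2 * (4 * μ₁ - (lam - (μ₁ - μ₂))) := mul_pos (by positivity) (by linarith)
    have f3 : 0 < t ^ 3 := by positivity
    have f4 : 0 < 4 * μ₁ * ((μ₁ - μ₂) * (μ₁ - lam)) :=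
      mul_pos (by positivity) (mul_pos (by linarith) (by linarith))
    linarith
  have hq0 : P lam μ₁ μ₂ z 1 0 = z / μ₁ * (lam + c) := by rw [P_one, zero_add]
  set q₀ := P lam μ₁ μ₂ z 1 0 with hq0def
  have hq0pos : 0 < q₀ := hpos 1
  have hqeq : μ₁ / z * q₀ = lam + c := by rw [hq0]; field_simp
  -- This is `(1 - z) (μ₂ z - lam) < 0`, the only place where `z < ρ₂` enters directly. It makes the
  -- step at `q₀`, equal to `lam / q₀ - μ₁`, positive.
  have hlq : μ₁ * q₀ < lam := by
    have h1 : μ₁ * q₀ = z * (lam + c) := by rw [hq0]; field_simp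
    rw [h1, hc]
    nlinarith
  have hdpos : 0 < lam / q₀ + μ₁ / z * q₀ - (lam + μ₁ + c) := by
    rw [hqeq]
    have := (lt_div_iff₀ hq0pos).2 hlq
    linarith
  obtain ⟨n, hn⟩ := exists_P_nonpos hz0 hμ₁ hdpos (μ₂ := μ₂) fun q hq hqle => by
    have h1 : 0 ≤ (q₀ - q) * (lam / (q * q₀) - μ₁ / z) := by
      refine mul_nonneg (by linarith) ?_
      rw [sub_nonneg, le_div_iff₀ (mul_pos hq hq0pos)]
      calc μ₁ / z * (q * q₀) = (μ₁ / z * q₀) * q := by ring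
        _ ≤ μ₁ * q₀ := by
          rw [hqeq]
          exact mul_le_mul hcμ hqle hq.le hμ₁.le
        _ ≤ lam := hlq.le
    have h2 : (q₀ - q) * (lam / (q * q₀) - μ₁ / z)
        = lam / q + μ₁ / z * q - (lam / q₀ + μ₁ / z * q₀) := by
      field_simp
      ring
    linarith
  exact absurd (hpos n) (not_lt.2 hn)

end Limit

end TandemQBD

/-! ### Proof of the theorem -/

theorem theorem8p1 (lam μ₁ μ₂ : ℝ) (hlam : 0 < lam) (hμ₁ : 0 < μ₁) (hμ₂ : 0 < μ₂) :
    (∀ m : ℕ, 1 ≤ m → TandemQBD.Stable lam μ₁ μ₂ m →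
      TandemQBD.IsMinimalH (TandemQBD.Q0 μ₁ m) (TandemQBD.Q1 lam μ₁ μ₂ m) (TandemQBD.Q2 μ₂ m)
        (TandemQBD.tandemH lam μ₁ μ₂ m) ∧
      ∃ z : ℝ,
        (z ∈ Set.Ioo (0 : ℝ) 1 ∧ TandemQBD.IsLargestZero lam μ₁ μ₂ z (m + 1) 0) ∧
        (∀ y ∈ Set.Ioo (0 : ℝ) 1, TandemQBD.IsLargestZero lam μ₁ μ₂ y (m + 1) 0 → y = z) ∧
        TandemQBD.IsMaximalEigenvalue (TandemQBD.tandemH lam μ₁ μ₂ m) z ∧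
        ∃ R : Matrix (Fin (m + 1)) (Fin (m + 1)) ℝ,
          TandemQBD.IsMinimalR (TandemQBD.Q0 μ₁ m) (TandemQBD.Q1 lam μ₁ μ₂ m)
            (TandemQBD.Q2 μ₂ m) R ∧
          TandemQBD.IsMaximalEigenvalue R z) ∧
    (lam < min μ₁ μ₂ →
      ∃ η : ℝ,
        (η ∈ Set.Ioo (0 : ℝ) 1 ∧ TandemQBD.tau lam μ₁ μ₂ η = 0) ∧
        (∀ y ∈ Set.Ioo (0 : ℝ) 1, TandemQBD.tau lam μ₁ μ₂ y = 0 → y = η) ∧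
        ∃ h : ℕ → ℝ,
          (∀ m : ℕ, 1 ≤ m →
            TandemQBD.IsMaximalEigenvalue (TandemQBD.tandemH lam μ₁ μ₂ m) (h m)) ∧
          StrictMonoOn h (Set.Ici 1) ∧
          (μ₁ ≤ μ₂ → Tendsto h atTop (𝓝 η)) ∧
          (μ₂ < μ₁ → Tendsto h atTop (𝓝 (lam / μ₂)))) := by
  open TandemQBD in
  constructor
  · intro m hm hst
    obtain ⟨z, hzI, hz, hz0, -⟩ :=
      exists_isLeast_isSuper hlam hμ₁ hμ₂ hm (hst.exists_isSuper hlam hμ₁ hμ₂ hm)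
    refine ⟨(isRateBlocks_tandem hlam hμ₁ hμ₂ m).isMinimalH_hitMatrix, z,
      ⟨hzI, hz.isLargestZero hlam hμ₁ hzI.1 hz0⟩, fun y hyI hy => ?_,
      isMaximalEigenvalue_tandemH hlam hμ₁ hμ₂ hzI hz hz0,
      exists_isMinimalR_tandem hlam hμ₁ hμ₂ hzI hz hz0⟩
    exact eq_of_isSuper hlam hμ₁ hμ₂ hyI hzI (hy.isSuper hlam hμ₁ hμ₂ hyI.1 hyI.2) hy.1 hz hz0
  · intro hmin
    obtain ⟨h1, h2⟩ := lt_min_iff.1 hmin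
    obtain ⟨η, hηI, hη⟩ := exists_tau_eq_zero hlam hμ₁ h1 (μ₂ := μ₂)
    have hηle : ∀ y ∈ Set.Ioo (0 : ℝ) 1, tau lam μ₁ μ₂ y ≤ 0 → η ≤ y := fun y hy hτ => by
      by_contra! hlt
      have := tau_neg_of_lt hlam hμ₁ hμ₂ h1 hy.1 hlt hηI.2 hτ
      linarith
    have hρI : lam / μ₂ ∈ Set.Ioo (0 : ℝ) 1 := ⟨div_pos hlam hμ₂, (div_lt_one hμ₂).2 h2⟩
    have hρ : lam / μ₂ < μ₁ / μ₂ := div_lt_div_of_pos_right h1 hμ₂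
    -- The implication sits inside the existential so that `choose` gives a sequence on all of `ℕ`;
    -- its value at `m = 0` is irrelevant.
    have hex : ∀ m, ∃ z, 1 ≤ m → z ∈ Set.Ioo (0 : ℝ) 1 ∧ IsSuper lam μ₁ μ₂ m (z, 0) ∧
        Phat lam μ₁ μ₂ z (m + 1) 0 = 0 ∧
        ∀ y ∈ Set.Ioo (0 : ℝ) 1, IsSuper lam μ₁ μ₂ m (y, 0) → z ≤ y := fun m => by
      by_cases hm : 1 ≤ m
      · obtain ⟨z, hz⟩ := exists_isLeast_isSuper hlam hμ₁ hμ₂ hm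
          ⟨_, hρI, (isSuper_rho₂ hlam hμ₁ hμ₂ h2 m).1⟩
        exact ⟨z, fun _ => hz⟩
      · exact ⟨0, fun h => absurd h hm⟩
    choose h hh using hex
    -- strict supersolutions lie strictly above the root
    have hlt : ∀ m, 1 ≤ m → ∀ y ∈ Set.Ioo (0 : ℝ) 1, IsSuper lam μ₁ μ₂ m (y, 0) →
        0 < Phat lam μ₁ μ₂ y (m + 1) 0 → h m < y := fun m hm y hyI hy hpos => by
      refine lt_of_le_of_ne ((hh m hm).2.2.2 y hyI hy) ?_
      rintro rfl
      exact hpos.ne' (hh m hm).2.2.1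
    have hhρ : ∀ m, 1 ≤ m → h m < lam / μ₂ := fun m hm =>
      hlt m hm _ hρI (isSuper_rho₂ hlam hμ₁ hμ₂ h2 m).1 (isSuper_rho₂ hlam hμ₁ hμ₂ h2 m).2
    have hmono : StrictMonoOn h (Set.Ici 1) := by
      refine strictMonoOn_of_lt_succ Set.ordConnected_Ici fun m _ hm hm' => ?_
      obtain ⟨hI, hS, -, -⟩ := hh (m + 1) hm'
      have := hS.of_succ hμ₁ hμ₂ hI.1 hI.2 ((hhρ (m + 1) hm').trans hρ)
      exact hlt m hm _ hI this.1 this.2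
    have hmono' : Monotone fun m => h (m + 1) := fun a b hab =>
      hmono.monotoneOn (by simp) (by simp) (by omega)
    have hlim0 := tendsto_atTop_ciSup hmono'
      ⟨lam / μ₂, by rintro _ ⟨m, rfl⟩; exact (hhρ (m + 1) (by omega)).le⟩
    set L := ⨆ m, h (m + 1) with hL
    have hlim : Tendsto h atTop (𝓝 L) := (tendsto_add_atTop_iff_nat 1).1 hlim0
    have hLρ : L ≤ lam / μ₂ := le_of_tendsto' hlim0 fun m => (hhρ (m + 1) (by omega)).le
    have hL0 : 0 < L := (hh 1 le_rfl).1.1.trans_le (hmono'.ge_of_tendsto hlim0 0)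
    have hLI : L ∈ Set.Ioo (0 : ℝ) 1 := ⟨hL0, hLρ.trans_lt hρI.2⟩
    have hnest : ∀ m, ∀ n, m ≤ n → ∀ z ∈ Set.Ioo (0 : ℝ) 1, z < μ₁ / μ₂ →
        IsSuper lam μ₁ μ₂ n (z, 0) → IsSuper lam μ₁ μ₂ m (z, 0) := fun m n hmn z hzI hz => by
      induction n, hmn using Nat.le_induction with
      | base => exact id
      | succ n _ ih => exact fun hS => ih (hS.of_succ hμ₁ hμ₂ hzI.1 hzI.2 hz).1
    -- For fixed `m`, nesting makes the later roots `h n` satisfy `IsSuper` at `m`; the closed form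
    -- of the condition passes to `L`, and positivity is then recovered.
    have hLpos : ∀ n, 0 < P lam μ₁ μ₂ L n 0 := fun m => by
      have hmem := (isClosed_setOf_nonneg lam μ₁ μ₂ m).mem_of_tendsto
        (hlim.prodMk_nhds (tendsto_const_nhds (x := (0 : ℝ)))) (by
          filter_upwards [eventually_ge_atTop (m + 1)] with n hn
          obtain ⟨hI, hS, -, -⟩ := hh n (by omega)
          have := hnest m n (by omega) _ hI ((hhρ n (by omega)).trans hρ) hS
          exact ⟨fun k hk => (this.1 k hk).le, this.2⟩)
      exact (isSuper_of_nonneg (p := (L, 0)) hlam hμ₁ hL0 hmem.1 hmem.2).1 m le_rfl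
    refine ⟨η, ⟨hηI, hη⟩, fun y hyI hy => ?_, h, fun m hm => ?_, hmono, fun h12 => ?_,
      fun h21 => ?_⟩
    · refine le_antisymm ?_ (hηle y hyI hy.le)
      by_contra! hlt
      exact (tau_neg_of_lt hlam hμ₁ hμ₂ h1 hηI.1 hlt hyI.2 hη.le).ne hy
    · obtain ⟨hI, hS, h0, -⟩ := hh m hm
      exact isMaximalEigenvalue_tandemH hlam hμ₁ hμ₂ hI hS h0
    · have hηρ : η ≤ lam / μ₁ := (hηle _ hρI (tau_rho₂_nonpos hlam hμ₁ hμ₂)).trans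
        (div_le_div_of_nonneg_left hlam.le hμ₁ h12)
      have hLη : L ≤ η := le_of_tendsto' hlim0 fun m => (hh (m + 1) (by omega)).2.2.2 η hηI
        (isSuper_of_tau_eq_zero hlam hμ₁ hηI.1 hη hηρ h1 (m + 1))
      rwa [le_antisymm hLη (hηle L hLI (tau_le_zero_of_pos hlam hμ₁ hL0 hLpos))] at hlim
    · rwa [le_antisymm hLρ (rho₂_le_of_pos hlam hμ₁ hμ₂ h1 h21 hL0 hLI.2 hLpos)] at hlim
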